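/- An ordered graph is a finite simple graph whose vertex set is totally ordered. An ordered homomorphism from an ordered graph $G$ to an ordered graph $H$ is a map $f : V(G) \to V(H)$ such that $f(u)f(v) \in E(H)$ for every $uv \in E(G)$, and $f(u) \le f(v)$ whenever $u \le v$. Let $\mathrm{RET}_<$ be the following decision problem. Input: an ordered graph $G$ and a subset $X \subseteq V(G)$. Question: is there an ordered homomorphism $f : G \to G[X]$ from $G$ to its induced ordered subgraph $G[X]$ with $f(x) = x$ for all $x \in X$? Theorem. $\mathrm{RET}_<$ is in $\mathsf{P}$: there are a deterministic Turing machine and a polynomial $p$ such that the machine, started on any word $w$ over the input alphabet, halts after at most $p(|w|)$ steps and answers correctly whether $w$ encodes a pair $(G,X)$ for which the answer to the question is yes. Here the vertices of $G$ are numbered $0 < 1 < \dots < n-1$ in their order, and $(G,X)$ is encoded by listing, for $i = 0, \dots, n-1$, one letter telling whether $i \in X$ followed by the $i$ adjacency-matrix entries of $i$ with $0, \dots, i-1$. -/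

import Mathlib

namespace OrderedGraph

/-- An ordered graph is a simple graph `G` on a linearly ordered vertex set `V`.
An ordered homomorphism preserves edges and the (non-strict) order of the vertices. -/
structure IsOrderedHom {V W : Type*} [LinearOrder V] [LinearOrder W]
    (G : SimpleGraph V) (H : SimpleGraph W) (f : V → W) : Prop where
  map_adj : ∀ u v : V, G.Adj u v → H.Adj (f u) (f v)
  map_le : ∀ u v : V, u ≤ v → f u ≤ f v

/-- An ordered retraction of `G` onto the induced ordered subgraph `G[X]`: an ordered
homomorphism from `G` to `G[X]` that is the identity on `X`. -/
structure IsOrderedRetraction {V : Type*} [LinearOrder V]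
    (G : SimpleGraph V) (X : Set V) (f : V → X) : Prop where
  isOrderedHom : IsOrderedHom G (G.induce X) f
  map_self : ∀ x : X, f x = x

/-- An input of the retraction problem: a finite ordered graph together with a set of its
vertices. The vertices are numbered `0, …, n - 1` along the order. -/
structure RetInstance where
  n : ℕ
  G : SimpleGraph (Fin n)
  X : Set (Fin n)

/-- The question of the retraction problem: does `G` have an ordered retraction onto `G[X]`? -/
def RetInstance.IsYes (I : RetInstance) : Prop :=
  ∃ f : Fin I.n → I.X, IsOrderedRetraction I.G I.X f

/-- The four-letter alphabet for inputs: a letter that opens a vertex and tells whether the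
vertex belongs to `X`, and the entries of the adjacency matrix. -/
inductive Letter
  | vertex (inX : Bool)
  | entry (adjacent : Bool)
  deriving DecidableEq, Fintype

open Classical in
/-- The part of the input that describes the vertex `i`: the letter for `i` itself, followed by
the row `i` of the adjacency matrix below the diagonal (the entries at `0, …, i - 1`). -/
noncomputable def RetInstance.row (I : RetInstance) (i : Fin I.n) : List Letter :=
  Letter.vertex (decide (i ∈ I.X)) ::
    List.ofFn fun j : Fin i => Letter.entry (decide (I.G.Adj i ⟨j, j.isLt.trans i.isLt⟩))

/-- The input as a word: the descriptions of the vertices, in increasing order. -/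
noncomputable def RetInstance.encode (I : RetInstance) : List Letter :=
  (List.ofFn fun i : Fin I.n => I.row i).flatten

/-- Different inputs are different words. -/
theorem RetInstance.encode_injective : Function.Injective RetInstance.encode := by
  have count : ∀ I : RetInstance,
      I.encode.countP (fun a => match a with | .vertex _ => true | .entry _ => false) = I.n := by
    intro I
    have hrow : ∀ i, (I.row i).countP
        (fun a => match a with | .vertex _ => true | .entry _ => false) = 1 := by
      intro i
      rw [RetInstance.row, List.countP_cons, List.countP_eq_zero.2]
      · rfl
      · intro a ha
        obtain ⟨j, rfl⟩ := (List.mem_ofFn' _ _).1 ha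
        simp
    simp [RetInstance.encode, List.countP_flatten, List.map_ofFn, Function.comp_def, hrow]
  rintro ⟨n, G, X⟩ ⟨m, H, Y⟩ h
  obtain rfl : n = m := by
    have h1 := count ⟨n, G, X⟩
    rw [h, count] at h1
    exact h1.symm
  have hrows : ∀ i : Fin n, RetInstance.row ⟨n, G, X⟩ i = RetInstance.row ⟨n, H, Y⟩ i := by
    refine congrFun (List.ofFn_injective ((List.eq_iff_flatten_eq).2 ⟨h, ?_⟩))
    simp [List.map_ofFn, Function.comp_def, RetInstance.row]
  have hX : X = Y := by
    ext i
    have h2 := (List.cons.inj (hrows i)).1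
    simpa using h2
  have hlt : ∀ i j : Fin n, j < i → (G.Adj i j ↔ H.Adj i j) := by
    intro i j hji
    have h2 := congrFun (List.ofFn_injective (List.cons.inj (hrows i)).2) ⟨j, hji⟩
    simpa using h2
  have hG : G = H := by
    ext i j
    rcases lt_trichotomy j i with hji | rfl | hij
    · exact hlt i j hji
    · simp
    · rw [G.adj_comm, H.adj_comm]
      exact hlt j i hij
  rw [hX, hG]

/-- The retraction problem as a formal language: the words that encode a yes-instance. -/
def RET : Language Letter :=
  {w | ∃ I : RetInstance, I.encode = w ∧ I.IsYes}

open Classical in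
/-- The complexity class `P` over the alphabet `α`: the languages for which some (multi-stack)
Turing machine, started on any word `w` whatsoever, halts after at most `p(|w|)` steps, for a
polynomial `p`, with the answer to `w ∈ L` as its output. -/
def PolyTime (α : Type) [Fintype α] : Set (Language α) :=
  {L | Nonempty (Turing.TM2ComputableInPolyTime (id : List α → List α) Computability.encodeBool
    (fun w => decide (w ∈ L)))}

end OrderedGraph

/-! ## Multi-head programs and their compilation to Turing machines -/

/-! An ordered retraction `f` onto `G[X]` leaves each vertex `u` at most two possible images. If `f
u ≤ u` and `z` is the largest element of `X` with `z ≤ u`, then `f u ≤ z` because `f u` lies in `X`,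
while `z = f z ≤ f u` because `f` is monotone and fixes `X`; so `f u = z`. Dually, if `u ≤ f u`,
then `f u` is the least element of `X` that is at least `u`. A retraction is thus one Boolean choice
per vertex, and every requirement on it (images in `X`, edges, order) involves at most two choices:
this is 2-SAT (`RetInstance.isYes_iff`).

The implications between literals are closed under contraposition, so a conflict-free choice exists
exactly when no literal and its opposite reach each other (`TwoSat.exists_assignment_iff`).
Reachability is found by propagating marks: a word of length `N` gives at most `2 * N` literals, so
`2 * N` sweeps suffice (`marked_closureMarks`).

For the time bound, the algorithm is a `HeadProg`, whose only loop repeats its body `N` times.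
Programs therefore always end, and a polynomial bound `cost` arises by recursion on the program. A
vertex is stored as a head position, and arithmetic is unary (`times`). The compilation `gets_code`
represents a tape by two stacks and gives each loop a tape of its own whose head counts the rounds;
`nonempty_computableInPolyTime` adds input and output.

Since the machine must answer on every word, encodings are recognised by a scan with two counters
(`exists_encode_eq_iff`). The effect of the whole program is a pure function of the word
(`run_decideRet`), and `mem_RET_iff` shows that this function decides the language. -/

/-- Programs for a machine with a finite memory `σ` and tapes `J` over the alphabet `α`. All tapes
have the same length `N`, and each has one head. The only loop is `rep`, which repeats `N` times. -/
inductive HeadProg (J σ α : Type) : Type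
  | left (j : J)
  | right (j : J)
  | load (j : J) (f : σ → Bool → Option α → σ)
  | write (j : J) (g : σ → α)
  | seq (p q : HeadProg J σ α)
  | ite (j : J) (c : σ → Bool → Option α → Bool) (p q : HeadProg J σ α)
  | rep (p : HeadProg J σ α)

namespace HeadProg

/-- The memory, the head positions and the contents of the tapes. -/
@[ext] structure State (J σ α : Type) where
  mem : σ
  pos : J → ℕ
  con : J → ℕ → α

/-! ### Semantics, labels and running time of programs. -/

section Semantics

variable {J σ α : Type} [DecidableEq J]

/-- Is the head of the tape `j` at the beginning? -/
def State.atStart (s : State J σ α) (j : J) : Bool := decide (s.pos j = 0)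

/-- The letter under the head of the tape `j`; there is none at the end of the tape. -/
def State.read (N : ℕ) (s : State J σ α) (j : J) : Option α :=
  if s.pos j < N then some (s.con j (s.pos j)) else none

/-- The effect of a program on tapes of length `N`. -/
def run (N : ℕ) : HeadProg J σ α → State J σ α → State J σ α
  | left j, s => { s with pos := Function.update s.pos j (s.pos j - 1) }
  | right j, s => { s with pos := Function.update s.pos j (min (s.pos j + 1) N) }
  | load j f, s => { s with mem := f s.mem (s.atStart j) (s.read N j) }
  | write j g, s =>
      if s.pos j < N then
        { s with con := Function.update s.con j (Function.update (s.con j) (s.pos j) (g s.mem)) }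
      else s
  | seq p q, s => run N q (run N p s)
  | ite j c p q, s => if c s.mem (s.atStart j) (s.read N j) then run N p s else run N q s
  | rep p, s => (run N p)^[N] s

/-- Moves are cut off at both ends of a tape. The bound is needed when a program runs after another
one, and it limits the stack heights at the end. -/
theorem run_pos_le (N : ℕ) (p : HeadProg J σ α) :
    ∀ s : State J σ α, (∀ j, s.pos j ≤ N) → ∀ j, (run N p s).pos j ≤ N := by
  induction p with
  | left j =>
    intro s h i
    simp only [run, Function.update_apply]
    split_ifs
    · have := h j; omega
    · exact h i
  | right j =>
    intro s h i
    simp only [run, Function.update_apply]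
    split_ifs
    · omega
    · exact h i
  | load j f => intro s h i; exact h i
  | write j g => intro s h i; simp only [run]; split_ifs <;> exact h i
  | seq p q hp hq => intro s h; exact hq _ (hp s h)
  | ite j c p q hp hq =>
    intro s h
    simp only [run]
    split_ifs
    · exact hp s h
    · exact hq s h
  | rep p hp =>
    intro s h
    simp only [run]
    have : ∀ k, ∀ j, ((run N p)^[k] s).pos j ≤ N := by
      intro k
      induction k with
      | zero => exact h
      | succ k ih => rw [Function.iterate_succ_apply']; exact hp _ ih
    exact this N

/-- The labels of the machine for a program: one at which the execution begins, those of the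
parts, and one for rewinding the tape that counts the rounds of a loop. -/
inductive Label : HeadProg J σ α → Type
  | start (p : HeadProg J σ α) : Label p
  | seqFst {p q : HeadProg J σ α} (l : Label p) : Label (seq p q)
  | seqSnd {p q : HeadProg J σ α} (l : Label q) : Label (seq p q)
  | iteFst {j : J} {c : σ → Bool → Option α → Bool} {p q : HeadProg J σ α} (l : Label p) :
      Label (ite j c p q)
  | iteSnd {j : J} {c : σ → Bool → Option α → Bool} {p q : HeadProg J σ α} (l : Label q) :
      Label (ite j c p q)
  | body {p : HeadProg J σ α} (l : Label p) : Label (rep p)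
  | rewind {p : HeadProg J σ α} : Label (rep p)

/-- Labels are nested like the program itself, so each occurrence of a subprogram has its own; a
Turing machine needs finitely many of them. -/
instance Label.finite (p : HeadProg J σ α) : Finite (Label p) := by
  induction p with
  | left j | right j | load j f | write j g =>
    exact Finite.of_surjective (fun _ : Unit => Label.start _) fun l => by cases l; exact ⟨(), rfl⟩
  | seq p q hp hq =>
    refine Finite.of_surjective
      (fun o : Option (Label p ⊕ Label q) => o.elim (Label.start _) (Sum.elim .seqFst .seqSnd))
      fun l => ?_
    cases l with
    | start => exact ⟨none, rfl⟩
    | seqFst l => exact ⟨some (.inl l), rfl⟩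
    | seqSnd l => exact ⟨some (.inr l), rfl⟩
  | ite j c p q hp hq =>
    refine Finite.of_surjective
      (fun o : Option (Label p ⊕ Label q) => o.elim (Label.start _) (Sum.elim .iteFst .iteSnd))
      fun l => ?_
    cases l with
    | start => exact ⟨none, rfl⟩
    | iteFst l => exact ⟨some (.inl l), rfl⟩
    | iteSnd l => exact ⟨some (.inr l), rfl⟩
  | rep p hp =>
    refine Finite.of_surjective
      (fun o : Option (Option (Label p)) => o.elim (Label.start _) fun o => o.elim .rewind .body)
      fun l => ?_
    cases l with
    | start => exact ⟨none, rfl⟩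
    | rewind => exact ⟨some none, rfl⟩
    | body l => exact ⟨some (some l), rfl⟩

/-- A bound for the running time of a program, in terms of the length of the tapes. -/
noncomputable def cost : HeadProg J σ α → Polynomial ℕ
  | seq p q => 1 + (cost p + cost q)
  | ite _ _ p q => 1 + (cost p + cost q)
  -- Each round costs the body and one step of the counter; one more step notices the end of the
  -- counter tape, and `N + 1` steps rewind it.
  | rep p => Polynomial.X * (cost p + 1) + 1 + (Polynomial.X + 1)
  | _ => 1

end Semantics

/-- The stacks of the machine: the input, its reversal, the output, and two stacks for each tape,
which hold the parts of the tape before and after the head. -/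
inductive Stack (τ : Type)
  | input
  | reversed
  | output
  | tape (t : τ) (after : Bool)
  deriving DecidableEq, Fintype

/-- The alphabets of the stacks. -/
@[reducible] def Stack.Alphabet {τ : Type} (α : Type) : Stack τ → Type
  | output => Bool
  | input => α
  | reversed => α
  | tape _ _ => α

/-- The part of a tape before or after the head. -/
def half {α : Type} (N : ℕ) (pos : ℕ) (con : ℕ → α) : Bool → List α
  | false => ((List.range pos).map con).reverse
  | true => (List.range' pos (N - pos)).map con

section Half

variable {α : Type} {N pos : ℕ} (con : ℕ → α)

theorem head_half_false : (half N pos con false).head? = none ↔ pos = 0 := by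
  cases pos <;> simp [half, List.range_succ]

theorem half_false_succ : half N (pos + 1) con false = con pos :: half N pos con false := by
  simp [half, List.range_succ]

theorem half_true_of_lt (h : pos < N) :
    half N pos con true = con pos :: half N (pos + 1) con true := by
  obtain ⟨k, rfl⟩ := Nat.exists_eq_add_of_lt h
  have h1 : pos + k + 1 - pos = k + 1 := by omega
  have h2 : pos + k + 1 - (pos + 1) = k := by omega
  simp [half, h1, h2, List.range'_succ]

theorem half_true_of_le (h : N ≤ pos) : half N pos con true = [] := by
  simp [half, Nat.sub_eq_zero_of_le h]

/-- The half before the head excludes the cell under it, so a write at the head (`i = pos`) leaves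
this half alone. -/
theorem half_update_of_lt_left (i : ℕ) (h : pos ≤ i) (a : α) :
    half N pos (Function.update con i a) false = half N pos con false := by
  simp only [half, List.reverse_inj]
  refine List.map_congr_left fun k hk => ?_
  rw [List.mem_range] at hk
  rw [Function.update_of_ne (by omega)]

theorem half_update_of_lt_right (i : ℕ) (h : i < pos) (a : α) :
    half N pos (Function.update con i a) true = half N pos con true := by
  simp only [half]
  refine List.map_congr_left fun k hk => ?_
  rw [List.mem_range'_1] at hk
  rw [Function.update_of_ne (by omega)]

end Half

/-! ### Simulation of programs by stack machines. -/

section Machine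

variable {τ Λ σ α : Type}

/-- The memory of the machine: that of the program, and two cells for letters from the stacks. -/
abbrev Memory (σ α : Type) : Type := σ × Option α × Option α

/-- Statements of the machine. -/
abbrev Code (τ Λ σ α : Type) : Type :=
  Turing.TM2.Stmt (K := Stack τ) (Stack.Alphabet α) Λ (Memory σ α)

open Turing.TM2.Stmt

/-- The machine gets from `c` to `c'` in at most `n` steps. -/
def Gets [DecidableEq τ] (M : Λ → Code τ Λ σ α) (n : ℕ)
    (c c' : Turing.TM2.Cfg (K := Stack τ) (Stack.Alphabet α) Λ (Memory σ α)) : Prop :=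
  ∃ m ≤ n, (flip bind (Turing.TM2.step M))^[m] (some c) = some c'

section Gets

variable [DecidableEq τ] {M : Λ → Code τ Λ σ α}
  {c c' c'' : Turing.TM2.Cfg (K := Stack τ) (Stack.Alphabet α) Λ (Memory σ α)} {m n : ℕ}

theorem Gets.refl (n : ℕ) : Gets M n c c := ⟨0, Nat.zero_le n, rfl⟩

theorem Gets.trans (h : Gets M m c c') (h' : Gets M n c' c'') : Gets M (m + n) c c'' := by
  obtain ⟨k, hk, e⟩ := h
  obtain ⟨k', hk', e'⟩ := h'
  exact ⟨k' + k, by omega, by rw [Function.iterate_add_apply, e, e']⟩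

theorem Gets.mono (h : Gets M m c c') (hmn : m ≤ n) : Gets M n c c' := by
  obtain ⟨k, hk, e⟩ := h
  exact ⟨k, hk.trans hmn, e⟩

theorem Gets.trans_eq (h : Gets M n c c') (e : c' = c'') : Gets M n c c'' := e ▸ h

theorem Gets.step {l : Λ} {v : Memory σ α} {S : (k : Stack τ) → List (k.Alphabet α)}
    (h : Turing.TM2.stepAux (M l) v S = c') : Gets M 1 ⟨some l, v, S⟩ c' :=
  ⟨1, le_rfl, by rw [← h]; rfl⟩

end Gets

section Read

variable {J : Type}

theorem isNone_head_half_false {N : ℕ} (s : State J σ α) (j : J) :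
    (half N (s.pos j) (s.con j) false).head?.isNone = s.atStart j := by
  rw [State.atStart, Bool.eq_iff_iff, decide_eq_true_iff, Option.isNone_iff_eq_none,
    head_half_false]

theorem head_half_true {N : ℕ} (s : State J σ α) (j : J) :
    (half N (s.pos j) (s.con j) true).head? = s.read N j := by
  rw [State.read]
  split_ifs with h
  · rw [half_true_of_lt _ h]; rfl
  · rw [half_true_of_le _ (not_lt.1 h)]; rfl

end Read

/-- Forget the letters in the cells and jump. -/
def jump (l : Λ) : Code τ Λ σ α :=
  Turing.TM2.Stmt.load (fun v => (v.1, none, none)) (goto fun _ => l)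

/-- Move the top letter from one half of the tape to the other, then jump. -/
def shift [Inhabited α] (t : τ) (b : Bool) (l l' : Λ) : Code τ Λ σ α :=
  pop (.tape t b) (fun v o => (v.1, o, none)) <|
    branch (fun v => v.2.1.isSome)
      (push (.tape t !b) (fun v => v.2.1.getD default) (jump l)) (jump l')

/-- Look at the two letters next to the head. -/
def sense (t : τ) (q : Code τ Λ σ α) : Code τ Λ σ α :=
  peek (.tape t false) (fun v o => (v.1, o, v.2.2)) <|
    peek (.tape t true) (fun v o => (v.1, v.2.1, o)) q

variable {J L : Type} [DecidableEq J]

/-- The machine code for a program, with the label to jump to at the end. -/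
def code {Λ : Type} [Inhabited α] :
    (p : HeadProg J σ α) → (Label p → L) → (L → Λ) → Λ → Label p → Code (J ⊕ L) Λ σ α
  | left j, _, _, exit, .start _ => shift (.inl j) false exit exit
  | right j, _, _, exit, .start _ => shift (.inl j) true exit exit
  | load j f, _, _, exit, .start _ =>
    sense (.inl j) <| Turing.TM2.Stmt.load
      (fun v => (f v.1 v.2.1.isNone v.2.2, none, none)) (jump exit)
  | write j g, _, _, exit, .start _ =>
    pop (.tape (.inl j) true) (fun v o => (v.1, o, none)) <|
      branch (fun v => v.2.1.isSome)
        (push (.tape (.inl j) true) (fun v => g v.1) (jump exit)) (jump exit)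
  | seq p _, emb, lab, _, .start _ => jump (lab (emb (.seqFst (.start p))))
  | seq p q, emb, lab, _, .seqFst l =>
    code p (fun l => emb (.seqFst l)) lab (lab (emb (.seqSnd (.start q)))) l
  | seq _ q, emb, lab, exit, .seqSnd l => code q (fun l => emb (.seqSnd l)) lab exit l
  | ite j c p q, emb, lab, _, .start _ =>
    sense (.inl j) <| branch (fun v => c v.1 v.2.1.isNone v.2.2)
      (jump (lab (emb (.iteFst (.start p))))) (jump (lab (emb (.iteSnd (.start q)))))
  | ite _ _ p _, emb, lab, exit, .iteFst l => code p (fun l => emb (.iteFst l)) lab exit l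
  | ite _ _ _ q, emb, lab, exit, .iteSnd l => code q (fun l => emb (.iteSnd l)) lab exit l
  -- The loop counts rounds on the tape indexed by its own start label. The letters there are
  -- irrelevant, only the length `N` matters.
  | rep p, emb, lab, _, .start _ => shift (.inr (emb (.start (rep p)))) true
      (lab (emb (.body (.start p)))) (lab (emb .rewind))
  | rep p, emb, lab, _, .body l =>
    code p (fun l => emb (.body l)) lab (lab (emb (.start (rep p)))) l
  | rep p, emb, lab, exit, .rewind =>
    shift (.inr (emb (.start (rep p)))) false (lab (emb .rewind)) exit

/-- The contents of the stacks while a program runs. -/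
def contents (N : ℕ) (pos : τ → ℕ) (con : τ → ℕ → α) : (k : Stack τ) → List (k.Alphabet α)
  | .input => []
  | .reversed => []
  | .output => []
  | .tape t b => half N (pos t) (con t) b

/-- The configuration of the machine at a state of the program. -/
def cfg (N : ℕ) (l : Λ) (s : State J σ α) (pos : L → ℕ) (con : L → ℕ → α) :
    Turing.TM2.Cfg (K := Stack (J ⊕ L)) (Stack.Alphabet α) Λ (Memory σ α) :=
  ⟨some l, (s.mem, none, none), contents N (Sum.elim s.pos pos) (Sum.elim s.con con)⟩

section StepAux

variable [DecidableEq τ] (N : ℕ) (pos : τ → ℕ) (con : τ → ℕ → α) (v : σ) (t : τ) (l l' : Λ)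

theorem stepAux_jump (v : Memory σ α) (S : (k : Stack τ) → List (k.Alphabet α)) :
    Turing.TM2.stepAux (jump l) v S = ⟨some l, (v.1, none, none), S⟩ := rfl

theorem stepAux_sense (q : Code τ Λ σ α) :
    Turing.TM2.stepAux (sense t q) (v, none, none) (contents N pos con) =
      Turing.TM2.stepAux q (v, (half N (pos t) (con t) false).head?,
        (half N (pos t) (con t) true).head?) (contents N pos con) := rfl

theorem contents_update_pos (p : ℕ) :
    Function.update (Function.update (contents N pos con) (.tape t false) (half N p (con t) false))
      (.tape t true) (half N p (con t) true) = contents N (Function.update pos t p) con := by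
  funext k
  rcases k with _ | _ | _ | ⟨t', b⟩
  · simp [contents]
  · simp [contents]
  · simp [contents]
  · by_cases h : t' = t
    · subst h
      cases b <;> simp [contents]
    · simp [contents, h]

theorem contents_update_con (c : ℕ → α) :
    Function.update (Function.update (contents N pos con) (.tape t false) (half N (pos t) c false))
      (.tape t true) (half N (pos t) c true) = contents N pos (Function.update con t c) := by
  funext k
  rcases k with _ | _ | _ | ⟨t', b⟩
  · simp [contents]
  · simp [contents]
  · simp [contents]
  · by_cases h : t' = t
    · subst h
      cases b <;> simp [contents]
    · simp [contents, h]

variable [Inhabited α]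

theorem stepAux_shift_true_of_lt (h : pos t < N) :
    Turing.TM2.stepAux (shift t true l l') (v, none, none) (contents N pos con) =
      ⟨some l, (v, none, none), contents N (Function.update pos t (pos t + 1)) con⟩ := by
  have e : contents N pos con (.tape t true) = con t (pos t) :: half N (pos t + 1) (con t) true :=
    half_true_of_lt _ h
  rw [← contents_update_pos, half_false_succ, Function.update_comm (by simp)]
  simp only [shift, Turing.TM2.stepAux, e]
  simp [stepAux_jump, contents]
  rfl

theorem stepAux_shift_true_of_le (h : N ≤ pos t) :
    Turing.TM2.stepAux (shift t true l l') (v, none, none) (contents N pos con) =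
      ⟨some l', (v, none, none), contents N pos con⟩ := by
  have e : contents N pos con (.tape t true) = [] := half_true_of_le _ h
  have u := Function.update_eq_self (.tape t true) (contents N pos con)
  rw [e] at u
  simp only [shift, Turing.TM2.stepAux, e]
  simp [stepAux_jump, u]

theorem stepAux_shift_false_succ (p : ℕ) (hp : pos t = p + 1) (h : p + 1 ≤ N) :
    Turing.TM2.stepAux (shift t false l l') (v, none, none) (contents N pos con) =
      ⟨some l, (v, none, none), contents N (Function.update pos t p) con⟩ := by
  have e : contents N pos con (.tape t false) = con t p :: half N p (con t) false := by
    simp only [contents, hp]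
    exact half_false_succ _
  have e' : contents N pos con (.tape t true) = half N (p + 1) (con t) true := by
    simp only [contents, hp]
  rw [← contents_update_pos, half_true_of_lt _ h]
  simp only [shift, Turing.TM2.stepAux, e]
  simp only [stepAux_jump, List.head?_cons, Option.isSome_some, cond_true, Option.getD_some,
    List.tail_cons]
  rw [Function.update_of_ne (by simp), ← e']
  rfl

theorem stepAux_shift_false_zero (h : pos t = 0) :
    Turing.TM2.stepAux (shift t false l l') (v, none, none) (contents N pos con) =
      ⟨some l', (v, none, none), contents N pos con⟩ := by
  have e : contents N pos con (.tape t false) = [] := by simp [contents, h, half]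
  have u := Function.update_eq_self (.tape t false) (contents N pos con)
  rw [e] at u
  simp only [shift, Turing.TM2.stepAux, e]
  simp [stepAux_jump, u]

end StepAux

variable [Inhabited α] [DecidableEq L]

/-- The machine code for a program simulates it within the time given by `cost`. -/
theorem gets_code (N : ℕ) (lab : L → Λ) (M : Λ → Code (J ⊕ L) Λ σ α) (con : L → ℕ → α)
    (p : HeadProg J σ α) : ∀ (emb : Label p → L) (_ : Function.Injective emb) (exit : Λ)
    (_ : ∀ l, M (lab (emb l)) = code p emb lab exit l) (s : State J σ α) (_ : ∀ j, s.pos j ≤ N)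
    (pos : L → ℕ) (_ : ∀ l, pos (emb l) = 0),
    Gets M ((cost p).eval N) (cfg N (lab (emb (.start p))) s pos con)
      (cfg N exit (run N p s) pos con) := by
  induction p with
  | left j =>
    intro emb _ exit hM s hs pos _
    simp only [cost, Polynomial.eval_one]
    refine Gets.step ?_
    rw [hM]
    simp only [code, run]
    rcases h : s.pos j with _ | p
    · rw [stepAux_shift_false_zero _ _ _ _ _ _ _ (by simpa using h)]
      rw [Nat.zero_sub, ← h, Function.update_eq_self]
      rfl
    · rw [stepAux_shift_false_succ _ _ _ _ _ _ _ p (by simpa using h) (h ▸ hs j)]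
      simp only [cfg, Sum.update_elim_inl, Nat.add_sub_cancel]
  | right j =>
    intro emb _ exit hM s hs pos _
    simp only [cost, Polynomial.eval_one]
    refine Gets.step ?_
    rw [hM]
    simp only [code, run]
    rcases lt_or_ge (s.pos j) N with h | h
    · rw [stepAux_shift_true_of_lt _ _ _ _ _ _ _ (by simpa using h), min_eq_left (by omega)]
      simp only [cfg, Sum.elim_inl, Sum.update_elim_inl]
    · rw [stepAux_shift_true_of_le _ _ _ _ _ _ _ (by simpa using h),
        min_eq_right (by omega), le_antisymm h (hs j)]
      simp only [cfg, Function.update_eq_self]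
  | load j f =>
    intro emb _ exit hM s hs pos _
    simp only [cost, Polynomial.eval_one]
    refine Gets.step ?_
    rw [hM]
    simp only [code, run, stepAux_sense, Turing.TM2.stepAux, stepAux_jump, Sum.elim_inl,
      isNone_head_half_false, head_half_true]
    rfl
  | write j g =>
    intro emb _ exit hM s hs pos _
    simp only [cost, Polynomial.eval_one]
    refine Gets.step ?_
    rw [hM]
    simp only [code, run]
    split_ifs with h
    · have e : contents N (Sum.elim s.pos pos) (Sum.elim s.con con) (.tape (.inl j) true) =
          s.con j (s.pos j) :: half N (s.pos j + 1) (s.con j) true := half_true_of_lt _ h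
      simp only [Turing.TM2.stepAux, e, cfg, ← Sum.update_elim_inl, ← contents_update_con,
        Sum.elim_inl]
      rw [half_true_of_lt _ h, half_update_of_lt_left _ _ le_rfl,
        half_update_of_lt_right _ _ (Nat.lt_succ_self _)]
      have e' : Function.update (contents N (Sum.elim s.pos pos) (Sum.elim s.con con))
          (.tape (.inl j) false) (half N (s.pos j) (s.con j) false) =
          contents N (Sum.elim s.pos pos) (Sum.elim s.con con) := Function.update_eq_self _ _
      rw [e']
      simp [stepAux_jump]
    · have e : contents N (Sum.elim s.pos pos) (Sum.elim s.con con) (.tape (.inl j) true) =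
          [] := half_true_of_le _ (not_lt.1 h)
      have u := Function.update_eq_self (.tape (.inl j) true)
        (contents N (Sum.elim s.pos pos) (Sum.elim s.con con))
      rw [e] at u
      simp only [Turing.TM2.stepAux, e, cfg]
      simp [stepAux_jump, u]
  | seq p q hp hq =>
    intro emb hemb exit hM s hs pos hpos
    simp only [cost, Polynomial.eval_add, Polynomial.eval_one]
    have start : Gets M 1 (cfg N (lab (emb (.start _))) s pos con)
        (cfg N (lab (emb (.seqFst (.start p)))) s pos con) := by
      refine Gets.step ?_
      rw [hM]
      rfl
    exact start.trans ((hp _ (fun _ _ h => Label.seqFst.inj (hemb h)) _ (fun l => hM _) s hs pos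
      fun l => hpos _).trans (hq _ (fun _ _ h => Label.seqSnd.inj (hemb h)) exit (fun l => hM _) _
        (run_pos_le N p s hs) pos fun l => hpos _))
  | ite j c p q hp hq =>
    intro emb hemb exit hM s hs pos hpos
    simp only [cost, Polynomial.eval_add, Polynomial.eval_one]
    have start : Gets M 1 (cfg N (lab (emb (.start _))) s pos con)
        (cfg N (if c s.mem (s.atStart j) (s.read N j) then lab (emb (.iteFst (.start p)))
          else lab (emb (.iteSnd (.start q)))) s pos con) := by
      refine Gets.step ?_
      rw [hM]
      simp only [code, stepAux_sense, Turing.TM2.stepAux, stepAux_jump, Sum.elim_inl,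
        isNone_head_half_false, head_half_true]
      cases c s.mem (s.atStart j) (s.read N j) <;> rfl
    refine start.trans ?_
    simp only [run]
    split_ifs with h
    · exact (hp _ (fun _ _ h => Label.iteFst.inj (hemb h)) exit
        (fun l => hM _) s hs pos fun l => hpos _).mono (Nat.le_add_right _ _)
    · exact (hq _ (fun _ _ h => Label.iteSnd.inj (hemb h)) exit
        (fun l => hM _) s hs pos fun l => hpos _).mono (Nat.le_add_left _ _)
  | rep p hp =>
    intro emb hemb exit hM s hs pos hpos
    simp only [cost, Polynomial.eval_add, Polynomial.eval_mul, Polynomial.eval_one,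
      Polynomial.eval_X]
    obtain ⟨h, hh⟩ : ∃ h, h = emb (.start _) := ⟨_, rfl⟩
    rw [← hh]
    -- The counters of loops inside the body belong to other labels, so they are still at 0 while
    -- this counter advances.
    have hne : ∀ l, emb (.body l) ≠ h := fun l hl => by simpa using hemb (hl.trans hh)
    have h0 : pos h = 0 := by rw [hh, hpos]
    -- After `k` rounds the counter stands at `k` and the start label is current again.
    have forward : ∀ k, k ≤ N →
        Gets M (k * ((cost p).eval N + 1)) (cfg N (lab h) s pos con)
          (cfg N (lab h) ((run N p)^[k] s) (Function.update pos h k) con) ∧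
        ∀ j, ((run N p)^[k] s).pos j ≤ N := by
      intro k
      induction k with
      | zero =>
        intro _
        refine ⟨?_, hs⟩
        rw [← h0, Function.update_eq_self, h0]
        exact Gets.refl _
      | succ k ih =>
        intro hk
        obtain ⟨ih, hle⟩ := ih (by omega)
        rw [Function.iterate_succ_apply']
        refine ⟨?_, run_pos_le N p _ hle⟩
        have step : Gets M 1 (cfg N (lab h) ((run N p)^[k] s) (Function.update pos h k) con)
            (cfg N (lab (emb (.body (.start p)))) ((run N p)^[k] s)
              (Function.update pos h (k + 1)) con) := by
          refine Gets.step ?_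
          rw [hh, hM]
          simp only [code]
          rw [← hh, stepAux_shift_true_of_lt _ _ _ _ _ _ _ (by simpa using hk)]
          simp only [cfg, Sum.update_elim_inr, Sum.elim_inr, Function.update_self, Function.update_idem]
        have body := hp _ (fun _ _ h => Label.body.inj (hemb h)) (lab h)
          (fun l => (hM (.body l)).trans (by rw [hh]; rfl)) _ hle
          (Function.update pos h (k + 1))
          (fun l => by rw [Function.update_of_ne (hne l)]; exact hpos _)
        exact ((ih.trans step).trans body).mono (by ring_nf; omega)
    -- The counter must return to 0 because an outer loop may enter this loop again.
    have backward : ∀ k, k ≤ N → ∀ s : State J σ α,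
        Gets M (k + 1) (cfg N (lab (emb .rewind)) s (Function.update pos h k) con)
          (cfg N exit s pos con) := by
      intro k
      induction k with
      | zero =>
        intro _ s
        refine Gets.step ?_
        rw [hM]
        simp only [code]
        rw [← hh, stepAux_shift_false_zero _ _ _ _ _ _ _ (by simp),
          ← h0, Function.update_eq_self]
        rfl
      | succ k ih =>
        intro hk s
        have step : Gets M 1 (cfg N (lab (emb .rewind)) s (Function.update pos h (k + 1)) con)
            (cfg N (lab (emb .rewind)) s (Function.update pos h k) con) := by
          refine Gets.step ?_
          rw [hM]
          simp only [code]
          rw [← hh, stepAux_shift_false_succ _ _ _ _ _ _ _ k (by simp) hk]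
          simp only [cfg, Sum.update_elim_inr, Function.update_idem]
        exact (step.trans (ih (by omega) s)).mono (by omega)
    obtain ⟨hf, -⟩ := forward N le_rfl
    have turn : Gets M 1 (cfg N (lab h) ((run N p)^[N] s) (Function.update pos h N) con)
        (cfg N (lab (emb .rewind)) ((run N p)^[N] s) (Function.update pos h N) con) := by
      refine Gets.step ?_
      rw [hh, hM]
      simp only [code]
      rw [← hh, stepAux_shift_true_of_le _ _ _ _ _ _ _ (by simp)]
      rfl
    exact (hf.trans turn).trans (backward N le_rfl _)

end Machine

end HeadProg

/-! ### Input, output and the complete machine. -/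

namespace HeadProg

theorem length_half_le {α : Type} {N : ℕ} (pos : ℕ) (h : pos ≤ N) (con : ℕ → α) (b : Bool) :
    (half N pos con b).length ≤ N := by
  cases b <;> simp [half, h]

section Machine

variable {τ Λ σ α : Type}

open Turing.TM2.Stmt

/-- The stacks with the given input, reversed input, output and halves of tapes. -/
def stacksOf (i r : List α) (o : List Bool) (T : τ × Bool → List α) :
    (k : Stack τ) → List (k.Alphabet α)
  | .input => i
  | .reversed => r
  | .output => o
  | .tape t b => T (t, b)

/-- Push the letter in the first cell on each of the halves in a list. -/
def pushAll [Inhabited α] (l : List (τ × Bool)) (q : Code τ Λ σ α) : Code τ Λ σ α :=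
  l.foldr (fun t q => push (.tape t.1 t.2) (fun v => v.2.1.getD default) q) q

/-- Pop a letter from each of the halves in a list, and keep the first letter found. -/
def popAll (l : List (τ × Bool)) (q : Code τ Λ σ α) : Code τ Λ σ α :=
  l.foldr (fun t q => pop (.tape t.1 t.2) (fun v o => (v.1, v.2.1.or o, none)) q) q

variable [DecidableEq τ]

theorem stacksOf_update (i r : List α) (o : List Bool) (T : τ × Bool → List α) (t : τ × Bool)
    (x : List α) :
    Function.update (stacksOf i r o T) (.tape t.1 t.2) x =
      stacksOf i r o (Function.update T t x) := by
  funext k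
  rcases k with _ | _ | _ | ⟨t', b⟩
  · simp [stacksOf]
  · simp [stacksOf]
  · simp [stacksOf]
  · by_cases h : (t', b) = t
    · subst h
      simp [stacksOf]
    · have h' : Stack.tape t' b ≠ .tape t.1 t.2 := by
        intro e
        injection e with e1 e2
        exact h (Prod.ext e1 e2)
      rw [Function.update_of_ne h']
      simp only [stacksOf]
      rw [Function.update_of_ne h]

theorem stacksOf_update_reversed (i r r' : List α) (o : List Bool) (T : τ × Bool → List α) :
    Function.update (stacksOf i r o T) .reversed r' = stacksOf i r' o T := by
  funext k
  rcases k with _ | _ | _ | _ <;> simp [stacksOf]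

theorem stacksOf_update_input (i i' r : List α) (o : List Bool) (T : τ × Bool → List α) :
    Function.update (stacksOf i r o T) .input i' = stacksOf i' r o T := by
  funext k
  rcases k with _ | _ | _ | _ <;> simp [stacksOf]

theorem stacksOf_update_output (i r : List α) (o o' : List Bool) (T : τ × Bool → List α) :
    Function.update (stacksOf i r o T) .output o' = stacksOf i r o' T := by
  funext k
  rcases k with _ | _ | _ | _ <;> simp [stacksOf]

/-- A statement may push on many stacks within one machine step; since the list has no duplicates,
each stack in it receives the letter once. -/
theorem stepAux_pushAll [Inhabited α] (l : List (τ × Bool)) (hl : l.Nodup) (q : Code τ Λ σ α)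
    (v : σ) (a : α) (i r : List α) (o : List Bool) (T : τ × Bool → List α) :
    Turing.TM2.stepAux (pushAll l q) (v, some a, none) (stacksOf i r o T) =
      Turing.TM2.stepAux q (v, some a, none)
        (stacksOf i r o fun t => if t ∈ l then a :: T t else T t) := by
  induction l generalizing T with
  | nil => simp [pushAll]
  | cons t l ih =>
    obtain ⟨htl, hl⟩ := List.nodup_cons.1 hl
    have e : pushAll (t :: l) q =
      push (.tape t.1 t.2) (fun v => v.2.1.getD default) (pushAll l q) := rfl
    rw [e, Turing.TM2.stepAux, stacksOf_update, ih hl]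
    congr 2
    funext t'
    by_cases h : t' = t
    · subst h
      simp [htl, stacksOf]
    · simp [h]

/-- The cell remains empty only if there was nothing to pop anywhere, which is how the machine
notices that all tapes are empty. -/
theorem stepAux_popAll (l : List (τ × Bool)) (hl : l.Nodup) (q : Code τ Λ σ α)
    (v : σ) (c : Option α) (i r : List α) (o : List Bool) (T : τ × Bool → List α) :
    ∃ c', (c' = none ↔ c = none ∧ ∀ t ∈ l, T t = []) ∧
    Turing.TM2.stepAux (popAll l q) (v, c, none) (stacksOf i r o T) =
      Turing.TM2.stepAux q (v, c', none)
        (stacksOf i r o fun t => if t ∈ l then (T t).tail else T t) := by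
  induction l generalizing T c with
  | nil => exact ⟨c, by simp, by simp [popAll]⟩
  | cons t l ih =>
    obtain ⟨htl, hl⟩ := List.nodup_cons.1 hl
    have e : popAll (t :: l) q =
      pop (.tape t.1 t.2) (fun v o => (v.1, v.2.1.or o, none)) (popAll l q) := rfl
    obtain ⟨c', hc, ih⟩ := ih hl (c.or (T t).head?) (Function.update T t (T t).tail)
    refine ⟨c', ?_, ?_⟩
    · rw [hc]
      simp only [Option.or_eq_none_iff, List.head?_eq_none_iff, List.mem_cons, forall_eq_or_imp,
        and_assoc]
      refine and_congr_right fun _ => and_congr_right fun _ => forall₂_congr fun t' ht' => ?_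
      rw [Function.update_of_ne]
      rintro rfl
      exact htl ht'
    · rw [e, Turing.TM2.stepAux, stacksOf_update]
      refine ih.trans ?_
      congr 2
      funext t'
      by_cases h : t' = t
      · subst h
        simp [htl]
      · simp [h]

end Machine

/-- The labels of a machine besides those of its program: for reversing the input, for writing it
on the tapes, and for emptying the tapes at the end. -/
inductive Phase
  | reverse
  | spread
  | clean
  deriving DecidableEq

instance : Fintype Phase :=
  ⟨{Phase.reverse, Phase.spread, Phase.clean}, by rintro (_ | _ | _) <;> simp⟩

section Decide

variable {J σ α : Type} [Fintype J] [DecidableEq J] [Inhabited α]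

open Turing.TM2.Stmt

/-- All halves of tapes. -/
noncomputable def halves (τ : Type) [Fintype τ] : List (τ × Bool) := Finset.univ.toList

/-- The later halves of all tapes. -/
noncomputable def lastHalves (τ : Type) [Fintype τ] : List (τ × Bool) :=
  (Finset.univ : Finset τ).toList.map fun t => (t, true)

theorem nodup_halves (τ : Type) [Fintype τ] : (halves τ).Nodup := Finset.nodup_toList _

theorem mem_halves {τ : Type} [Fintype τ] (t : τ × Bool) : t ∈ halves τ :=
  Finset.mem_toList.2 (Finset.mem_univ t)

theorem nodup_lastHalves (τ : Type) [Fintype τ] : (lastHalves τ).Nodup :=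
  (Finset.nodup_toList _).map fun _ _ h => (Prod.ext_iff.1 h).1

theorem mem_lastHalves {τ : Type} [Fintype τ] (t : τ × Bool) : t ∈ lastHalves τ ↔ t.2 = true := by
  obtain ⟨t, b⟩ := t
  simp [lastHalves, eq_comm]

variable (p : HeadProg J σ α) (v₀ : σ) (out : σ → Bool)

noncomputable instance : Fintype (Label p) := Fintype.ofFinite _

noncomputable instance : DecidableEq (Label p) := Classical.decEq _

/-- The code of the machine that writes its input on the tapes, runs a program, empties the tapes,
and returns a function of the memory. -/
noncomputable def machineCode : Label p ⊕ Phase → Code (J ⊕ Label p) (Label p ⊕ Phase) σ α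
  | .inl l => code p id .inl (.inr .clean) l
  | .inr .reverse =>
    pop .input (fun v o => (v.1, o, none)) <|
      branch (fun v => v.2.1.isSome)
        (push .reversed (fun v => v.2.1.getD default) (jump (.inr .reverse)))
        (jump (.inr .spread))
  | .inr .spread =>
    pop .reversed (fun v o => (v.1, o, none)) <|
      branch (fun v => v.2.1.isSome)
        (pushAll (lastHalves _) (jump (.inr .spread))) (jump (.inl (.start p)))
  | .inr .clean =>
    popAll (halves _) <|
      branch (fun v => v.2.1.isSome) (jump (.inr .clean)) <|
        push .output (fun v => out v.1) <| Turing.TM2.Stmt.load (fun _ => (v₀, none, none)) halt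

/-- Moving a stack letter by letter reverses it. Reversing the input once beforehand makes its first
letter end up on top of the tapes. -/
theorem gets_reverse (v : σ) (i r : List α) :
    Gets (machineCode p v₀ out) (i.length + 1)
      ⟨some (.inr .reverse), (v, none, none), stacksOf i r [] fun _ => []⟩
      ⟨some (.inr .spread), (v, none, none), stacksOf [] (i.reverse ++ r) [] fun _ => []⟩ := by
  induction i generalizing r with
  | nil =>
    refine Gets.step ?_
    simp only [machineCode, Turing.TM2.stepAux, stacksOf_update_input, stepAux_jump]
    rfl
  | cons a i ih =>
    have step : Gets (machineCode p v₀ out) 1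
        ⟨some (.inr .reverse), (v, none, none), stacksOf (a :: i) r [] fun _ => []⟩
        ⟨some (.inr .reverse), (v, none, none), stacksOf i (a :: r) [] fun _ => []⟩ := by
      refine Gets.step ?_
      simp only [machineCode, Turing.TM2.stepAux, stacksOf_update_input, stepAux_jump,
        stacksOf_update_reversed]
      rfl
    refine ((step.trans (ih (a :: r))).mono (by simp; omega)).trans_eq ?_
    simp

/-- Every tape receives the input, the loop counters included; this gives all tapes the common
length `N`. -/
theorem gets_spread (v : σ) (r l : List α) :
    Gets (machineCode p v₀ out) (r.length + 1)
      ⟨some (.inr .spread), (v, none, none), stacksOf [] r [] fun t => if t.2 then l else []⟩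
      ⟨some (.inl (.start p)), (v, none, none),
        stacksOf [] [] [] fun t => if t.2 then r.reverse ++ l else []⟩ := by
  induction r generalizing l with
  | nil =>
    refine Gets.step ?_
    simp only [machineCode, Turing.TM2.stepAux, stacksOf_update_reversed, stepAux_jump]
    rfl
  | cons a r ih =>
    have step : Gets (machineCode p v₀ out) 1
        ⟨some (.inr .spread), (v, none, none),
          stacksOf [] (a :: r) [] fun t => if t.2 then l else []⟩
        ⟨some (.inr .spread), (v, none, none),
          stacksOf [] r [] fun t => if t.2 then a :: l else []⟩ := by
      refine Gets.step ?_
      simp only [machineCode, Turing.TM2.stepAux, stacksOf_update_reversed]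
      refine (stepAux_pushAll _ (nodup_lastHalves _) _ v a _ _ _ _).trans ?_
      rw [stepAux_jump]
      congr 2
      funext t
      simp only [mem_lastHalves]
      split_ifs <;> rfl
    refine ((step.trans (ih (a :: l))).mono (by simp; omega)).trans_eq ?_
    simp

/-- A halting configuration must have nothing on its stacks but the output. One step removes a
letter from every nonempty half, and a last step finds them all empty. -/
theorem gets_clean (v : σ) (m : ℕ) (T : (J ⊕ Label p) × Bool → List α)
    (hT : ∀ t, (T t).length ≤ m) :
    Gets (machineCode p v₀ out) (m + 1)
      ⟨some (.inr .clean), (v, none, none), stacksOf [] [] [] T⟩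
      ⟨none, (v₀, none, none), stacksOf [] [] [out v] fun _ => []⟩ := by
  induction m generalizing T with
  | zero =>
    obtain ⟨c, hc, h⟩ := stepAux_popAll (halves _) (nodup_halves (J ⊕ Label p))
      (branch (fun v => v.2.1.isSome) (jump (.inr .clean)) <|
        push .output (fun v => out v.1) <| Turing.TM2.Stmt.load (fun _ => (v₀, none, none)) halt :
        Code (J ⊕ Label p) (Label p ⊕ Phase) σ α) v none [] [] [] T
    have hT' : ∀ t, T t = [] := fun t => List.length_eq_zero_iff.1 (Nat.le_zero.1 (hT t))
    obtain rfl := hc.2 ⟨rfl, fun t _ => hT' t⟩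
    refine Gets.step (h.trans ?_)
    simp only [Turing.TM2.stepAux, stacksOf_update_output]
    simp [hT', stacksOf]
  | succ m ih =>
    obtain ⟨c, hc, h⟩ := stepAux_popAll (halves _) (nodup_halves (J ⊕ Label p))
      (branch (fun v => v.2.1.isSome) (jump (.inr .clean)) <|
        push .output (fun v => out v.1) <| Turing.TM2.Stmt.load (fun _ => (v₀, none, none)) halt :
        Code (J ⊕ Label p) (Label p ⊕ Phase) σ α) v none [] [] [] T
    -- The bound `m + 1` need not be attained: the halves may all be empty already.
    rcases c with _ | a
    · have hT' : ∀ t, T t = [] := fun t => (hc.1 rfl).2 t (mem_halves t)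
      refine (Gets.step (h.trans ?_)).mono (by omega)
      simp only [Turing.TM2.stepAux, stacksOf_update_output]
      simp [hT', stacksOf]
    · have step : Gets (machineCode p v₀ out) 1
          ⟨some (.inr .clean), (v, none, none), stacksOf [] [] [] T⟩
          ⟨some (.inr .clean), (v, none, none), stacksOf [] [] [] fun t => (T t).tail⟩ := by
        refine Gets.step (h.trans ?_)
        simp only [mem_halves, if_true, Turing.TM2.stepAux, Option.isSome_some, cond_true,
          stepAux_jump]
      exact (step.trans (ih _ fun t => by rw [List.length_tail]; have := hT t; omega)).mono
        (by omega)

/-- What a program decides can be decided in polynomial time. -/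
theorem nonempty_computableInPolyTime [Fintype σ] [Fintype α] :
    Nonempty (Turing.TM2ComputableInPolyTime (id : List α → List α) Computability.encodeBool
      fun w => out (run w.length p ⟨v₀, fun _ => 0, fun _ i => w.getD i default⟩).mem) := by
  let tm : Turing.FinTM2 :=
    { K := Stack (J ⊕ Label p)
      k₀ := .input
      k₁ := .output
      Γ := Stack.Alphabet α
      Λ := Label p ⊕ Phase
      main := .inr .reverse
      σ := Memory σ α
      initialState := (v₀, none, none)
      Γk₀Fin := inferInstanceAs (Fintype α)
      m := machineCode p v₀ out }
  refine ⟨⟨⟨tm, Equiv.refl α, Equiv.refl Bool⟩,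
    -- The summands pay for reversing, spreading, running the program, and cleaning.
    (Polynomial.X + 1) + (Polynomial.X + 1) + cost p + (Polynomial.X + 1),
    fun w => Classical.choice ?_⟩⟩
  set s : State J σ α := ⟨v₀, fun _ => 0, fun _ i => w.getD i default⟩ with hs
  have hs0 : ∀ j, s.pos j ≤ w.length := fun j => Nat.zero_le _
  have h1 := gets_reverse p v₀ out v₀ w []
  have h2 := gets_spread p v₀ out v₀ w.reverse []
  have h3 := gets_code w.length Sum.inl (machineCode p v₀ out) (fun _ i => w.getD i default) p id
    Function.injective_id (.inr .clean) (fun _ => rfl) s hs0 (fun _ => 0) fun _ => rfl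
  have h4 := gets_clean p v₀ out (run w.length p s).mem w.length
    (fun t => half w.length
      ((Sum.elim (run w.length p s).pos fun _ => 0 : J ⊕ Label p → ℕ) t.1)
      ((Sum.elim (run w.length p s).con fun _ i => w.getD i default :
        J ⊕ Label p → ℕ → α) t.1) t.2) (by
      rintro ⟨j | l, b⟩
      · exact length_half_le _ (run_pos_le _ _ _ hs0 j) _ _
      · exact length_half_le _ (Nat.zero_le _) _ _)
  have e2 : stacksOf (τ := J ⊕ Label p) [] (w.reverse ++ []) [] (fun _ => []) =
      stacksOf [] w.reverse [] fun t => if t.2 then [] else [] := by simp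
  have e3 : (stacksOf [] [] [] fun t : (J ⊕ Label p) × Bool =>
      if t.2 then w.reverse.reverse ++ [] else []) =
      contents w.length (Sum.elim s.pos fun _ => 0) (Sum.elim s.con fun _ i => w.getD i default) := by
    have hw : (List.range' 0 (w.length - 0)).map (fun i => w.getD i default) = w := by
      refine List.ext_getElem (by simp) fun i h1 h2 => ?_
      simp [h2]
    funext k
    rcases k with _ | _ | _ | ⟨j | l, b⟩
    · rfl
    · rfl
    · rfl
    · cases b
      · rfl
      · simp only [stacksOf, contents, Sum.elim_inl, hs, half, hw]
        simp
    · cases b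
      · rfl
      · simp only [stacksOf, contents, Sum.elim_inr, half, hw]
        simp
  have e4 : contents w.length (Sum.elim (run w.length p s).pos fun _ => 0)
      (Sum.elim (run w.length p s).con fun (_ : Label p) i => w.getD i default) =
      stacksOf [] [] [] fun t => half w.length
        ((Sum.elim (run w.length p s).pos fun _ => 0 : J ⊕ Label p → ℕ) t.1)
        ((Sum.elim (run w.length p s).con fun _ i => w.getD i default :
          J ⊕ Label p → ℕ → α) t.1) t.2 := by
    funext k
    rcases k with _ | _ | _ | ⟨t, b⟩
    · rfl
    · rfl
    · rfl
    · exact rfl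
  rw [e2] at h1
  rw [e3, List.length_reverse] at h2
  unfold cfg at h3
  rw [e4] at h3
  obtain ⟨m, hm, e⟩ := ((h1.trans h2).trans h3).trans h4
  refine ⟨⟨⟨m, ?_⟩, by simpa using hm⟩⟩
  have ei : Turing.initList tm (List.map (Equiv.refl α).invFun (id w)) =
      ⟨some (.inr .reverse), (v₀, none, none), stacksOf w [] [] fun _ => []⟩ := by
    simp only [Turing.initList]
    congr 1
    funext k
    rcases k with _ | _ | _ | _
    · exact List.map_id w
    · rfl
    · rfl
    · rfl
  have eo : Turing.haltList tm [out (run w.length p s).mem] =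
      ⟨none, (v₀, none, none), stacksOf [] [] [out (run w.length p s).mem] fun _ => []⟩ := by
    simp only [Turing.haltList]
    congr 1
    funext k
    rcases k with _ | _ | _ | _ <;> rfl
  refine (congrArg (fun c => (flip bind tm.step)^[m] (some c)) ei).trans (e.trans ?_)
  exact congrArg some eo.symm

end Decide

end HeadProg

/-! ## Boolean constraints on pairs of literals -/

namespace TwoSat

variable {V : Type}

/-- The opposite literal. -/
def neg (x : V × Bool) : V × Bool := (x.1, !x.2)

theorem neg_neg (x : V × Bool) : neg (neg x) = x := by simp [neg]

/-- The literal `y` follows from `x` if `x` conflicts with the opposite of `y`. -/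
def Edge (bad : V × Bool → V × Bool → Prop) (x y : V × Bool) : Prop := bad x (neg y)

variable {bad : V × Bool → V × Bool → Prop} (hbad : ∀ x y, bad x y → bad y x)

include hbad

/-- Contraposition; this is where the symmetry of conflicts enters. -/
theorem edge_neg {x y : V × Bool} (h : Edge bad x y) : Edge bad (neg y) (neg x) := by
  rw [Edge, neg_neg]
  exact hbad _ _ h

theorem reach_neg {x y : V × Bool} (h : Relation.ReflTransGen (Edge bad) x y) :
    Relation.ReflTransGen (Edge bad) (neg y) (neg x) := by
  induction h with
  | refl => exact .refl
  | tail _ h ih => exact .head (edge_neg hbad h) ih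

/-- Literals can be chosen without conflicts if no literal is equivalent to its opposite. -/
theorem exists_assignment_iff [Finite V] :
    (∃ b : V → Bool, ∀ u v, ¬ bad (u, b u) (v, b v)) ↔
      ∀ u : V, ¬ (Relation.ReflTransGen (Edge bad) (u, false) (u, true) ∧
        Relation.ReflTransGen (Edge bad) (u, true) (u, false)) := by
  constructor
  · rintro ⟨b, hb⟩ u ⟨h, h'⟩
    -- Truth under a conflict-free assignment propagates along implications, so a cycle through a
    -- literal and its opposite would make both true.
    have key : ∀ x y, Relation.ReflTransGen (Edge bad) x y → x.2 = b x.1 → y.2 = b y.1 := by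
      intro x y hxy hx
      induction hxy with
      | refl => exact hx
      | @tail y z _ h ih =>
        by_contra hz
        have hz' : (!z.2) = b z.1 := by
          cases h1 : z.2 <;> cases h2 : b z.1 <;> simp_all
        refine hb y.1 z.1 ?_
        rw [← ih, ← hz']
        exact h
    cases hu : b u
    · exact absurd (key _ _ h hu.symm) (by simp [hu])
    · exact absurd (key _ _ h' hu.symm) (by simp [hu])
  · intro hcyc
    -- The assignment is read off a maximal set of literals that is closed under implication and
    -- contains no opposite pair.
    obtain ⟨S, ⟨hclosed, hcons⟩, hmax⟩ := Set.Finite.exists_maximal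
      (s := {S : Set (V × Bool) | (∀ x ∈ S, ∀ y, Edge bad x y → y ∈ S) ∧ ∀ x ∈ S, neg x ∉ S})
      (Set.toFinite _) ⟨∅, by simp⟩
    have hreach : ∀ x ∈ S, ∀ y, Relation.ReflTransGen (Edge bad) x y → y ∈ S := by
      intro x hx y hxy
      induction hxy with
      | refl => exact hx
      | tail _ h ih => exact hclosed _ ih _ h
    have htotal : ∀ u, (u, true) ∈ S ∨ (u, false) ∈ S := by
      intro u
      by_contra! hu
      have hu' : ∀ s, (u, s) ∉ S := by
        rintro (_ | _)
        exacts [hu.2, hu.1]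
      obtain ⟨s, hs⟩ : ∃ s, ¬ Relation.ReflTransGen (Edge bad) (u, s) (u, !s) := by
        by_contra! h
        exact hcyc u ⟨h false, h true⟩
      -- If `S` misses both literals of `u`, it can be enlarged by all that follows from `(u, s)`.
      -- An opposite pair arising in this way would, by contraposition, put `(u, !s)` into `S` or
      -- make `(u, s)` imply it.
      have hT : S ∪ {x | Relation.ReflTransGen (Edge bad) (u, s) x} ⊆ S := by
        refine hmax ⟨?_, ?_⟩ Set.subset_union_left
        · rintro x (hx | hx) y hxy
          · exact .inl (hclosed x hx y hxy)
          · exact .inr (.tail hx hxy)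
        · rintro x (hx | hx) (hx' | hx')
          · exact hcons x hx hx'
          · have h := reach_neg hbad hx'
            rw [neg_neg] at h
            exact hu' _ (hreach x hx _ h)
          · exact hu' _ (hreach _ hx' _ (reach_neg hbad hx))
          · have h := reach_neg hbad hx'
            rw [neg_neg] at h
            exact hs (Relation.ReflTransGen.trans hx h)
      exact hu' s (hT (.inr .refl))
    classical
    have hmem : ∀ u, (u, decide ((u, true) ∈ S)) ∈ S := by
      intro u
      by_cases h : (u, true) ∈ S
      · simp [h]
      · simpa [h] using (htotal u).resolve_left h
    refine ⟨fun u => decide ((u, true) ∈ S), fun u v huv => ?_⟩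
    refine hcons _ (hmem v) (hclosed _ (hmem u) _ ?_)
    rw [Edge, neg_neg]
    exact huv

end TwoSat

/-! ## Retractions as solutions of constraints -/

namespace OrderedGraph

section Nearest

variable (N : ℕ) (P : ℕ → Bool)

/-- One step down, unless `P` holds. -/
def down (x : ℕ) : ℕ := if P x then x else x - 1

/-- One step up, but not beyond `N`, unless `P` holds. -/
def up (x : ℕ) : ℕ := if P x then x else min (x + 1) N

/-- The nearest number with the property `P` below or above `x` (in the other direction if there is
none in the given one). -/
def nearest : Bool → ℕ → ℕ
  | false, x => (up N P)^[N] ((down P)^[N] x)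
  | true, x => (down P)^[N] ((up N P)^[N] x)

variable {N P}

/-- The walk stops at the first point with `P`. Either it has stopped, or it has made all `k` steps,
truncated at 0. -/
theorem down_iterate (x k : ℕ) : (down P)^[k] x ≤ x ∧
    (∀ i, (down P)^[k] x < i → i ≤ x → ¬ P i) ∧
    (P ((down P)^[k] x) ∨ (down P)^[k] x = x - k) := by
  induction k with
  | zero => exact ⟨le_rfl, fun i h h' => absurd h (not_lt.2 h'), .inr rfl⟩
  | succ k ih =>
    rw [Function.iterate_succ_apply']
    obtain ⟨h1, h2, h3⟩ := ih
    generalize (down P)^[k] x = d at *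
    by_cases hd : P d
    · simp only [down, hd, if_true]
      exact ⟨h1, h2, .inl trivial⟩
    · simp only [down, hd]
      have h3 := h3.resolve_left hd
      refine ⟨by simp; omega, fun i hi hix => ?_, .inr (by simp; omega)⟩
      rcases eq_or_ne i d with rfl | hne
      · exact hd
      · exact h2 i (by simp at hi; omega) hix

theorem up_iterate (x k : ℕ) (hx : x ≤ N) : x ≤ (up N P)^[k] x ∧ (up N P)^[k] x ≤ N ∧
    (∀ i, x ≤ i → i < (up N P)^[k] x → ¬ P i) ∧
    (P ((up N P)^[k] x) ∨ (up N P)^[k] x = min (x + k) N) := by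
  induction k with
  | zero =>
    exact ⟨le_rfl, hx, fun i h h' => absurd h' (not_lt.2 h), .inr (by simp [hx])⟩
  | succ k ih =>
    rw [Function.iterate_succ_apply']
    obtain ⟨h1, h1', h2, h3⟩ := ih
    generalize (up N P)^[k] x = d at *
    by_cases hd : P d
    · simp only [up, hd, if_true]
      exact ⟨h1, h1', h2, .inl trivial⟩
    · simp only [up, hd]
      have h3 := h3.resolve_left hd
      refine ⟨by simp; omega, by simp, fun i hi hix => ?_, .inr (by simp; omega)⟩
      rcases eq_or_ne i d with rfl | hne
      · exact hd
      · exact h2 i hi (by simp at hix; omega)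

theorem down_iterate_spec {x y : ℕ} (hx : x ≤ N) (hy : P y) (hyx : y ≤ x) :
    P ((down P)^[N] x) ∧ y ≤ (down P)^[N] x ∧ (down P)^[N] x ≤ x := by
  obtain ⟨h1, h2, h3⟩ := down_iterate (P := P) x N
  have h4 : y ≤ (down P)^[N] x := by
    by_contra h
    exact h2 y (by omega) hyx hy
  refine ⟨?_, h4, h1⟩
  rcases h3 with h3 | h3
  · exact h3
  -- From `x ≤ N`, a walk of `N` steps that never stopped has come down to 0, where it can only have
  -- met `y` itself.
  · have : y = (down P)^[N] x := by omega
    rwa [← this]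

/-- A walk that never stopped would have reached `N`, beyond `y`; hence `y < N` is required. -/
theorem up_iterate_spec {x y : ℕ} (hyN : y < N) (hy : P y) (hxy : x ≤ y) :
    P ((up N P)^[N] x) ∧ x ≤ (up N P)^[N] x ∧ (up N P)^[N] x ≤ y := by
  obtain ⟨h1, h1', h2, h3⟩ := up_iterate (P := P) x N (by omega : x ≤ N)
  have h4 : (up N P)^[N] x ≤ y := by
    by_contra h
    exact h2 y hxy (by omega) hy
  refine ⟨?_, h1, h4⟩
  rcases h3 with h3 | h3
  · exact h3
  · omega

theorem down_iterate_of_pos {x : ℕ} (hx : P x) (k : ℕ) : (down P)^[k] x = x :=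
  Function.iterate_fixed (by simp [down, hx]) k

theorem up_iterate_of_pos {x : ℕ} (hx : P x) (k : ℕ) : (up N P)^[k] x = x :=
  Function.iterate_fixed (by simp [up, hx]) k

/-- Once the walk down has found a point with `P`, the walk back up is idle. -/
theorem nearest_false_spec {x y : ℕ} (hx : x ≤ N) (hy : P y) (hyx : y ≤ x) :
    P (nearest N P false x) ∧ y ≤ nearest N P false x ∧ nearest N P false x ≤ x := by
  have h := down_iterate_spec hx hy hyx
  rw [nearest, up_iterate_of_pos h.1]
  exact h

theorem nearest_true_spec {x y : ℕ} (hyN : y < N) (hy : P y) (hxy : x ≤ y) :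
    P (nearest N P true x) ∧ x ≤ nearest N P true x ∧ nearest N P true x ≤ y := by
  have h := up_iterate_spec hyN hy hxy
  rw [nearest, down_iterate_of_pos h.1]
  exact h

theorem nearest_of_pos {x : ℕ} (hx : P x) (s : Bool) : nearest N P s x = x := by
  cases s <;> simp [nearest, down_iterate_of_pos hx, up_iterate_of_pos hx]

end Nearest

/-! ### Retractions as two-valued choices. -/

/-- Sending `a` to `x` and `b` to `y` is not part of an ordered retraction onto the graph with the
vertices `P` and the adjacency `A`. -/
def conflict (P : ℕ → Bool) (A : ℕ → ℕ → Bool) (a x b y : ℕ) : Bool :=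
  !P x || !P y || (A a b && !A x y) || (decide (a ≤ b) && !decide (x ≤ y)) ||
    (decide (b ≤ a) && !decide (y ≤ x))

/-- The choice of an end for `a` conflicts with the choice of an end for `b`. -/
def clash (N : ℕ) (P : ℕ → Bool) (A : ℕ → ℕ → Bool) (a : ℕ × Bool) (b : ℕ × Bool) : Bool :=
  conflict P A a.1 (nearest N P a.2 a.1) b.1 (nearest N P b.2 b.1)

/-- Provides the symmetry of conflicts on which contraposition of implications rests. -/
theorem conflict_comm {P : ℕ → Bool} {A : ℕ → ℕ → Bool} (hA : ∀ i j, A i j = A j i)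
    (a x b y : ℕ) : conflict P A a x b y = conflict P A b y a x := by
  rw [Bool.eq_iff_iff]
  simp only [conflict, hA a b, hA x y, Bool.or_eq_true, Bool.and_eq_true]
  tauto

open Classical in
/-- Is `i` one of the chosen vertices? -/
noncomputable def RetInstance.chosen (I : RetInstance) (i : ℕ) : Bool :=
  decide (∃ h : i < I.n, (⟨i, h⟩ : Fin I.n) ∈ I.X)

open Classical in
/-- Are `i` and `j` adjacent? -/
noncomputable def RetInstance.adj (I : RetInstance) (i j : ℕ) : Bool :=
  decide (∃ (hi : i < I.n) (hj : j < I.n), I.G.Adj ⟨i, hi⟩ ⟨j, hj⟩)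

theorem RetInstance.chosen_val (I : RetInstance) (i : Fin I.n) : I.chosen i ↔ i ∈ I.X := by
  simp [chosen]

theorem RetInstance.adj_val (I : RetInstance) (i j : Fin I.n) : I.adj i j ↔ I.G.Adj i j := by
  simp [adj]

theorem RetInstance.lt_of_chosen (I : RetInstance) {i : ℕ} (h : I.chosen i) : i < I.n := by
  simp only [chosen, decide_eq_true_eq] at h
  exact h.1

theorem RetInstance.adj_comm (I : RetInstance) (i j : ℕ) : I.adj i j = I.adj j i := by
  rw [Bool.eq_iff_iff]
  simp only [adj, decide_eq_true_eq]
  constructor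
  · rintro ⟨hi, hj, h⟩
    exact ⟨hj, hi, h.symm⟩
  · rintro ⟨hi, hj, h⟩
    exact ⟨hj, hi, h.symm⟩

/-- A retraction is a choice of ends without clashes. -/
theorem RetInstance.isYes_iff (I : RetInstance) (N : ℕ) (hN : I.n ≤ N) :
    I.IsYes ↔ ∃ b : Fin I.n → Bool, ∀ u v : Fin I.n,
      ¬ clash N I.chosen I.adj (u, b u) (v, b v) = true := by
  constructor
  · rintro ⟨f, ⟨hadj, hle⟩, hself⟩
    have hf : ∀ u : Fin I.n, I.chosen (f u).1 := fun u => (I.chosen_val _).2 (f u).2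
    -- The key observation: the image of `u` is the nearest chosen vertex on one of its two sides.
    have hend : ∀ u : Fin I.n, ∃ s, nearest N I.chosen s u = (f u).1 := by
      intro u
      rcases le_total (f u).1 u with h | h
      · obtain ⟨h1, h2, h3⟩ := nearest_false_spec (N := N) (by omega) (hf u)
          (show ((f u).1 : ℕ) ≤ u from h)
        refine ⟨false, le_antisymm ?_ h2⟩
        have hn := I.lt_of_chosen h1
        -- The nearest chosen vertex below `u` is fixed by `f`, so monotonicity puts it at or below
        -- `f u`; `h2` is the opposite inequality.
        have h4 := hle ⟨_, hn⟩ u h3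
        have hs := hself ⟨⟨_, hn⟩, (I.chosen_val ⟨_, hn⟩).1 h1⟩
        rw [hs] at h4
        exact h4
      · obtain ⟨h1, h2, h3⟩ := nearest_true_spec (N := N) (by omega) (hf u)
          (show (u : ℕ) ≤ (f u).1 from h)
        refine ⟨true, le_antisymm h3 ?_⟩
        have hn := I.lt_of_chosen h1
        have h4 := hle u ⟨_, hn⟩ h2
        have hs := hself ⟨⟨_, hn⟩, (I.chosen_val ⟨_, hn⟩).1 h1⟩
        rw [hs] at h4
        exact h4
    choose b hb using hend
    refine ⟨b, fun u v => ?_⟩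
    have e1 : (I.adj u v && !I.adj (f u).1 (f v).1) = false := by
      rw [Bool.and_eq_false_iff, Bool.not_eq_false', ← Bool.not_eq_true, I.adj_val, I.adj_val]
      by_cases h : I.G.Adj u v
      · exact .inr (hadj u v h)
      · exact .inl h
    simp only [clash, conflict, hb, hf, e1]
    simpa using And.intro (hle u v) (hle v u)
  -- Conversely, the absence of clashes says that the chosen ends lie in `X` and respect edges and
  -- order; `X` is fixed because a chosen vertex is its own nearest one.
  · rintro ⟨b, hb⟩
    have hb' : ∀ u v : Fin I.n, I.chosen (nearest N I.chosen (b u) u) ∧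
        (I.adj u v → I.adj (nearest N I.chosen (b u) u) (nearest N I.chosen (b v) v)) ∧
        (u ≤ v → nearest N I.chosen (b u) u ≤ nearest N I.chosen (b v) v) := by
      intro u v
      have h := hb u v
      simp only [clash, conflict, Bool.or_eq_true, Bool.and_eq_true, Bool.not_eq_true',
        decide_eq_true_eq, decide_eq_false_iff_not, not_or, not_and, not_not,
        Bool.not_eq_false] at h
      exact ⟨h.1.1.1.1, h.1.1.2, h.1.2⟩
    have hlt : ∀ u : Fin I.n, nearest N I.chosen (b u) u < I.n :=
      fun u => I.lt_of_chosen (hb' u u).1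
    refine ⟨fun u => ⟨⟨_, hlt u⟩, (I.chosen_val ⟨_, hlt u⟩).1 (hb' u u).1⟩, ⟨?_, ?_⟩, ?_⟩
    · intro u v huv
      exact (I.adj_val ⟨_, hlt u⟩ ⟨_, hlt v⟩).1 ((hb' u v).2.1 ((I.adj_val u v).2 huv))
    · intro u v huv
      exact (hb' u v).2.2 huv
    · intro x
      exact Subtype.ext (Fin.ext (nearest_of_pos ((I.chosen_val x.1).2 x.2) _))

end OrderedGraph

/-! ## Words that encode instances -/

namespace OrderedGraph

/-- The description of the vertex `i` in a graph with vertices `p` and adjacency `q`. -/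
def rowWord (p : ℕ → Bool) (q : ℕ → ℕ → Bool) (i : ℕ) : List Letter :=
  .vertex (p i) :: (List.range i).map fun j => .entry (q i j)

/-- The description of the first `n` vertices. -/
def graphWord (p : ℕ → Bool) (q : ℕ → ℕ → Bool) (n : ℕ) : List Letter :=
  (List.range n).flatMap (rowWord p q)

/-- The length of the description of the first `n` vertices. -/
def tri : ℕ → ℕ
  | 0 => 0
  | n + 1 => tri n + (n + 1)

theorem tri_mono : Monotone tri := monotone_nat_of_le_succ fun n => by simp only [tri]; omega

theorem le_tri (n : ℕ) : n ≤ tri n := by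
  induction n with
  | zero => exact le_rfl
  | succ n ih => simp only [tri]; omega

section GraphWord

variable (p : ℕ → Bool) (q : ℕ → ℕ → Bool)

theorem graphWord_succ (n : ℕ) : graphWord p q (n + 1) = graphWord p q n ++ rowWord p q n := by
  simp [graphWord, List.range_succ, List.flatMap_append]

theorem length_graphWord (n : ℕ) : (graphWord p q n).length = tri n := by
  induction n with
  | zero => rfl
  | succ n ih => simp [graphWord_succ, ih, rowWord, tri]

/-- The rows before `i` take up `tri i` letters, and row `i` opens with its vertex letter, whence
the `+ 1`. -/
theorem graphWord_getElem? {n i j : ℕ} (hi : i < n) (hj : j < i) :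
    (graphWord p q n)[tri i + 1 + j]? = some (.entry (q i j)) := by
  induction n with
  | zero => omega
  | succ n ih =>
    rw [graphWord_succ]
    rcases (Nat.lt_succ_iff_lt_or_eq.1 hi) with h | rfl
    · rw [List.getElem?_append_left, ih h]
      have := tri_mono h
      simp only [tri] at this
      rw [length_graphWord]
      omega
    · rw [List.getElem?_append_right (by rw [length_graphWord]; omega), length_graphWord]
      have : tri i + 1 + j - tri i = j + 1 := by omega
      simp [this, rowWord, hj]

variable {p q}

theorem graphWord_congr {p' : ℕ → Bool} {q' : ℕ → ℕ → Bool} {n : ℕ}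
    (hp : ∀ i < n, p i = p' i) (hq : ∀ i < n, ∀ j < i, q i j = q' i j) :
    graphWord p q n = graphWord p' q' n := by
  refine List.flatMap_congr fun i hi => ?_
  rw [List.mem_range] at hi
  rw [rowWord, rowWord, hp i hi]
  congr 1
  refine List.map_congr_left fun j hj => ?_
  rw [List.mem_range] at hj
  rw [hq i hi j hj]

end GraphWord

/-- Replaces functions on `Fin` by total functions on `ℕ`, so that words can be built up by
recursion on the number of vertices. -/
theorem RetInstance.encode_eq (I : RetInstance) : I.encode = graphWord I.chosen I.adj I.n := by
  rw [encode, graphWord, List.flatMap, ← List.ofFn_getElem (xs := List.map _ _)]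
  congr 1
  refine List.ext_getElem (by simp) fun i h1 h2 => ?_
  simp only [List.length_ofFn] at h1
  simp only [List.getElem_ofFn, List.getElem_map, List.getElem_range, row, rowWord]
  congr 1
  · simp [chosen, h1]
  · refine List.ext_getElem (by simp) fun j h3 h4 => ?_
    simp only [List.length_ofFn] at h3
    simp [adj, h1, h3.trans h1]

/-! ### Recognising well-formed words. -/

/-- One step in checking the form of a word: the state is whether there was no mistake so far, the
number of vertices, and the number of missing entries for the last of them. -/
def checkStep (s : Bool × ℕ × ℕ) : Letter → Bool × ℕ × ℕ
  | .vertex _ => (s.1 && decide (s.2.2 = 0), s.2.1 + 1, s.2.1)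
  | .entry _ => (s.1 && !decide (s.2.2 = 0), s.2.1, s.2.2 - 1)

/-- The result of checking the form of a word. -/
def check (w : List Letter) : Bool × ℕ × ℕ := w.foldl checkStep (true, 0, 0)

theorem foldl_checkStep_entries (f : ℕ → Letter) (hf : ∀ i, ∃ b, f i = .entry b) (c r k : ℕ) :
    ((List.range k).map f).foldl checkStep (true, c, r + k) = (true, c, r) := by
  induction k generalizing r with
  | zero => rfl
  | succ k ih =>
    obtain ⟨b, hb⟩ := hf k
    have : r + (k + 1) = r + 1 + k := by omega
    rw [List.range_succ, List.map_append, List.foldl_append, this, ih]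
    simp [hb, checkStep]

theorem check_graphWord (p : ℕ → Bool) (q : ℕ → ℕ → Bool) (n : ℕ) :
    check (graphWord p q n) = (true, n, 0) := by
  induction n with
  | zero => rfl
  | succ n ih =>
    rw [check, graphWord_succ, List.foldl_append, ← check, ih, rowWord, List.foldl_cons]
    have := foldl_checkStep_entries (fun j => .entry (q n j)) (fun i => ⟨_, rfl⟩) (n + 1) 0 n
    simpa [checkStep] using this

/-- Induction on prefixes: a word without mistakes so far consists of complete rows and one initial
piece of a row, of which `r` entries are missing. -/
theorem exists_of_check (w : List Letter) : ∀ c r, check w = (true, c, r) →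
    (w = [] ∧ c = 0 ∧ r = 0) ∨ ∃ (p : ℕ → Bool) (q : ℕ → ℕ → Bool) (k : ℕ), c = k + 1 ∧ r ≤ k ∧
      w = graphWord p q k ++
        .vertex (p k) :: (List.range (k - r)).map fun j => .entry (q k j) := by
  induction w using List.reverseRecOn with
  | nil =>
    intro c r h
    simp only [check, List.foldl_nil, Prod.mk.injEq, true_and] at h
    exact .inl ⟨rfl, h.1.symm, h.2.symm⟩
  | append_singleton w a ih =>
    intro c r h
    rw [check, List.foldl_append, ← check] at h
    rcases hw : check w with ⟨b, c', r'⟩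
    rw [hw] at h
    right
    rcases a with x | x
    · simp only [List.foldl_cons, checkStep, List.foldl_nil, Prod.mk.injEq, Bool.and_eq_true,
        decide_eq_true_eq] at h
      obtain ⟨⟨rfl, rfl⟩, rfl, rfl⟩ := h
      rcases ih _ _ hw with ⟨rfl, rfl, -⟩ | ⟨p, q, k, rfl, -, e⟩
      · exact ⟨fun _ => x, fun _ _ => false, 0, rfl, le_rfl, rfl⟩
      -- No entry was missing, so rows `0` to `k` are complete and a row for `k + 1` opens; `p` has
      -- not been used there yet.
      · refine ⟨Function.update p (k + 1) x, q, k + 1, rfl, le_rfl, ?_⟩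
        have e' : w = graphWord p q (k + 1) := by rw [e, graphWord_succ]; rfl
        rw [e', graphWord_congr (p' := Function.update p (k + 1) x) (q' := q)
          (fun i hi => by rw [Function.update_of_ne (by omega)]) fun _ _ _ _ => rfl]
        simp
    · simp only [List.foldl_cons, checkStep, List.foldl_nil, Prod.mk.injEq, Bool.and_eq_true,
        Bool.not_eq_true', decide_eq_false_iff_not] at h
      obtain ⟨⟨rfl, hr⟩, rfl, rfl⟩ := h
      rcases ih _ _ hw with ⟨-, -, h⟩ | ⟨p, q, k, rfl, hk, e⟩
      · exact absurd h hr
      -- With `r'` entries missing, the next one in row `k` is in column `k - r'`.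
      · refine ⟨p, Function.update q k (Function.update (q k) (k - r') x), k, rfl, by omega, ?_⟩
        have h1 : k - (r' - 1) = (k - r') + 1 := by omega
        rw [e, h1, List.range_succ, List.map_append]
        rw [graphWord_congr (p' := p)
          (q' := Function.update q k (Function.update (q k) (k - r') x)) (fun _ _ => rfl)
          fun i hi j _ => by rw [Function.update_of_ne (by omega)]]
        have h2 : (List.range (k - r')).map (fun j => Letter.entry
            (Function.update q k (Function.update (q k) (k - r') x) k j)) =
            (List.range (k - r')).map (fun j => Letter.entry (q k j)) := by
          refine List.map_congr_left fun j hj => ?_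
          rw [List.mem_range] at hj
          rw [Function.update_self, Function.update_of_ne (by omega)]
        rw [h2]
        simp

/-- The words of the right form are those that encode instances. -/
theorem exists_encode_eq_iff (w : List Letter) :
    (∃ I : RetInstance, I.encode = w) ↔ (check w).1 = true ∧ (check w).2.2 = 0 := by
  constructor
  · rintro ⟨I, rfl⟩
    rw [I.encode_eq, check_graphWord]
    exact ⟨rfl, rfl⟩
  · intro h
    rcases hw : check w with ⟨b, c, r⟩
    rw [hw] at h
    obtain ⟨rfl, rfl⟩ := h
    obtain ⟨p, q, n, e⟩ : ∃ p q n, w = graphWord p q n := by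
      rcases exists_of_check w _ _ hw with ⟨rfl, -, -⟩ | ⟨p, q, k, -, -, e⟩
      · exact ⟨fun _ => false, fun _ _ => false, 0, rfl⟩
      · exact ⟨p, q, k + 1, by rw [e, graphWord_succ]; rfl⟩
    -- Only the values of `q` below the diagonal occur in the word; they are mirrored to obtain a
    -- symmetric relation without loops.
    refine ⟨⟨n, ⟨fun i j => (j < i ∧ q i j) ∨ (i < j ∧ q j i), ⟨fun i j h => h.symm⟩,
      ⟨fun i h => by simp at h⟩⟩, {i | p i}⟩, ?_⟩
    rw [RetInstance.encode_eq, e]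
    refine graphWord_congr (fun i hi => ?_) fun i hi j hj => ?_
    · have hi' : i < n := hi
      simp [RetInstance.chosen, hi']
    · have hi' : i < n := hi
      have hj' : j < n := hj.trans hi
      simp [RetInstance.adj, hi', hj', hj, hj.le]

/-! ### Reading the graph off a word. -/

/-- The `i`-th letter that opens a vertex. -/
def vertexLetter (w : List Letter) (i : ℕ) : Letter :=
  (w.filter fun a => a matches .vertex _).getD i (.entry false)

/-- The entry of the vertices `j < i`. -/
def entryAt (w : List Letter) (i j : ℕ) : Bool :=
  decide (j < i) && decide (w[tri i + 1 + j]? = some (.entry true))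

/-- Without the entries, the letter of vertex `i` stands at position `i`, so a head position on such
a list can serve as a vertex. -/
theorem filter_graphWord (p : ℕ → Bool) (q : ℕ → ℕ → Bool) (n : ℕ) :
    (graphWord p q n).filter (fun a => a matches .vertex _) =
      (List.range n).map fun i => .vertex (p i) := by
  induction n with
  | zero => rfl
  | succ n ih =>
    have h : ((List.range n).map fun j => Letter.entry (q n j)).filter
        (fun a => a matches .vertex _) = [] := by
      rw [List.filter_eq_nil_iff]
      intro a ha
      obtain ⟨j, -, rfl⟩ := List.mem_map.1 ha
      simp
    rw [graphWord_succ, List.filter_append, ih, rowWord, List.filter_cons, h, List.range_succ,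
      List.map_append]
    simp

theorem RetInstance.vertexLetter_encode (I : RetInstance) (i : ℕ) :
    vertexLetter I.encode i = if i < I.n then .vertex (I.chosen i) else .entry false := by
  rw [vertexLetter, I.encode_eq, filter_graphWord]
  split_ifs with h <;> simp [List.getD, h]

/-- For `i` beyond the last vertex, the position looked up lies past the end of the word. -/
theorem RetInstance.entryAt_encode (I : RetInstance) (i j : ℕ) :
    entryAt I.encode i j = (decide (j < i) && I.adj i j) := by
  rw [entryAt, I.encode_eq]
  by_cases hj : j < i
  · by_cases hi : i < I.n
    · simp [graphWord_getElem? _ _ hi hj]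
    · have h1 : I.adj i j = false := by simp [adj, hi]
      have h2 : tri I.n ≤ tri i := tri_mono (not_lt.1 hi)
      rw [List.getElem?_eq_none (by rw [length_graphWord]; omega), h1]
      simp
  · simp [hj]

theorem RetInstance.adj_eq_entryAt (I : RetInstance) (i j : ℕ) :
    I.adj i j = (entryAt I.encode i j || entryAt I.encode j i) := by
  rw [I.entryAt_encode, I.entryAt_encode, I.adj_comm j i]
  rcases lt_trichotomy i j with h | rfl | h
  · simp [h, h.le]
  · simp [adj]
  · simp [h, h.le]

/-- Lets the length of the word, which is the number of rounds of every loop, replace the number of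
vertices. -/
theorem RetInstance.n_le_length_encode (I : RetInstance) : I.n ≤ I.encode.length := by
  rw [I.encode_eq, length_graphWord]
  exact le_tri _

end OrderedGraph

/-! ## Building blocks for multi-head programs -/

namespace HeadProg

variable {J σ α : Type}

section Memory

/-- Change the memory. -/
def State.setMem (s : State J σ α) (v : σ) : State J σ α := { s with mem := v }

variable (s : State J σ α)

@[simp] theorem State.setMem_mem (v : σ) : (s.setMem v).mem = v := rfl

@[simp] theorem State.setMem_pos (v : σ) : (s.setMem v).pos = s.pos := rfl

@[simp] theorem State.setMem_con (v : σ) : (s.setMem v).con = s.con := rfl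

@[simp] theorem State.setMem_setMem (v v' : σ) : (s.setMem v).setMem v' = s.setMem v' := rfl

end Memory

variable [DecidableEq J]

section State

/-- Move a head. -/
def State.setPos (s : State J σ α) (j : J) (k : ℕ) : State J σ α :=
  { s with pos := Function.update s.pos j k }

variable (s : State J σ α) {i j : J} (k l : ℕ)

@[simp] theorem State.setPos_mem : (s.setPos j k).mem = s.mem := rfl

@[simp] theorem State.setPos_con : (s.setPos j k).con = s.con := rfl

@[simp] theorem State.setPos_pos_self : (s.setPos j k).pos j = k := Function.update_self _ _ _

theorem State.setPos_pos_of_ne (h : i ≠ j) : (s.setPos j k).pos i = s.pos i :=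
  Function.update_of_ne h _ _

theorem State.setPos_pos : (s.setPos j k).pos i = if i = j then k else s.pos i :=
  Function.update_apply _ _ _ _

@[simp] theorem State.setPos_setPos : (s.setPos j k).setPos j l = s.setPos j l := by
  simp [setPos]

theorem State.setPos_comm (h : i ≠ j) :
    (s.setPos i k).setPos j l = (s.setPos j l).setPos i k := by
  simp only [setPos, Function.update_comm h]

variable {s k} in
theorem State.setPos_eq_self (h : s.pos j = k) : s.setPos j k = s := by
  subst h
  simp [setPos]

theorem State.setMem_setPos (v : σ) : (s.setMem v).setPos j k = (s.setPos j k).setMem v := rfl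

variable (N : ℕ)

theorem run_left : run N (left j) s = s.setPos j (s.pos j - 1) := rfl

theorem run_right : run N (right j) s = s.setPos j (min (s.pos j + 1) N) := rfl

theorem run_load (f : σ → Bool → Option α → σ) :
    run N (load j f) s = s.setMem (f s.mem (s.atStart j) (s.read N j)) := rfl

theorem run_seq (p q : HeadProg J σ α) : run N (seq p q) s = run N q (run N p s) := rfl

theorem run_ite (c : σ → Bool → Option α → Bool) (p q : HeadProg J σ α) :
    run N (ite j c p q) s =
      if c s.mem (s.atStart j) (s.read N j) then run N p s else run N q s := rfl

theorem run_rep (p : HeadProg J σ α) : run N (rep p) s = (run N p)^[N] s := rfl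

end State

/-- Do nothing. -/
def skip (j : J) : HeadProg J σ α := load j fun v _ _ => v

theorem run_skip (N : ℕ) (j : J) (s : State J σ α) : run N (skip j) s = s := rfl

/-- Move a head to the beginning. -/
def rewind (j : J) : HeadProg J σ α := rep (left j)

/-- Execute a program as often as the position of `i` says; the head `t` is used for counting. -/
def times (i t : J) (p : HeadProg J σ α) : HeadProg J σ α :=
  seq (rep (ite i (fun _ z _ => z) (skip i) (seq (left i) (seq (right t) p))))
    (rep (ite t (fun _ z _ => z) (skip t) (seq (left t) (right i))))

/-- Execute a program for each position of `j`. -/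
def forEach (j : J) (p : HeadProg J σ α) : HeadProg J σ α :=
  seq (rep (seq p (right j))) (rewind j)

/-- Shows how a loop of exactly `N` rounds acts as one of `k ≤ N` rounds: the remaining rounds are
idle. -/
theorem iterate_countdown {β : Type*} {f : β → β} {S : ℕ → β} {k N : ℕ} (hk : k ≤ N)
    (h : ∀ m < k, f (S (m + 1)) = S m) (h0 : f (S 0) = S 0) : f^[N] (S k) = S 0 := by
  induction k generalizing N with
  | zero => exact Function.iterate_fixed h0 N
  | succ k ih =>
    obtain ⟨N, rfl⟩ : ∃ M, N = M + 1 := ⟨N - 1, by omega⟩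
    rw [Function.iterate_succ_apply, h k (by omega)]
    exact ih (by omega) fun m hm => h m (by omega)

theorem iterate_countup {β : Type*} {f : β → β} {S : ℕ → β} {N : ℕ}
    (h : ∀ m < N, f (S m) = S (m + 1)) : ∀ k ≤ N, f^[k] (S 0) = S k := by
  intro k
  induction k with
  | zero => intro _; rfl
  | succ k ih =>
    intro hk
    rw [Function.iterate_succ_apply', ih (by omega), h k (by omega)]

variable {N : ℕ}

theorem run_rewind {s : State J σ α} {j : J} (h : s.pos j ≤ N) :
    run N (rewind j) s = s.setPos j 0 := by
  have := iterate_countdown (f := run N (left j)) (S := fun m => s.setPos j m) h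
    (fun m _ => by simp [run_left]) (by simp [run_left])
  rw [State.setPos_eq_self rfl] at this
  exact this

/-- `S m` describes everything but the heads `i` and `t` when `m` rounds remain. The body sees `i`
at `m`, already decreased; the second loop of `times` restores `i` and `t`. -/
theorem run_times {i t : J} (hit : i ≠ t) (p : HeadProg J σ α) (S : ℕ → State J σ α) {k : ℕ}
    (hk : k ≤ N) (h : ∀ m < k, run N p (((S (m + 1)).setPos i m).setPos t (k - m)) =
      ((S m).setPos i m).setPos t (k - m)) :
    run N (times i t p) (((S k).setPos i k).setPos t 0) = ((S 0).setPos i k).setPos t 0 := by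
  have h1 := iterate_countdown
    (f := run N (ite i (fun _ z _ => z) (skip i) (seq (left i) (seq (right t) p))))
    (S := fun m => ((S m).setPos i m).setPos t (k - m)) hk (by
      intro m hm
      have e : min (k - (m + 1) + 1) N = k - m := by omega
      simp only [run_ite, State.atStart, State.setPos_pos_of_ne _ _ hit, State.setPos_pos_self,
        run_seq, run_left, run_right, State.setPos_comm _ _ _ hit.symm, State.setPos_setPos,
        Nat.add_sub_cancel]
      rw [← h m hm]
      simp [e])
    (by simp [run_ite, State.atStart, State.setPos_pos_of_ne _ _ hit, run_skip])
  have h2 := iterate_countdown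
    (f := run N (ite t (fun _ z _ => z) (skip t) (seq (left t) (right i)) : HeadProg J σ α))
    (S := fun m => ((S 0).setPos i (k - m)).setPos t m) hk (by
      intro m hm
      have e : min (k - (m + 1) + 1) N = k - m := by omega
      simp [run_ite, State.atStart, State.setPos_pos_of_ne _ _ hit,
        run_seq, run_left, run_right, State.setPos_comm _ _ _ hit.symm, e])
    (by simp [run_ite, State.atStart, run_skip])
  simp only [Nat.sub_self, Nat.sub_zero] at h1 h2
  rw [times, run_seq, run_rep, run_rep, h1, h2]

/-- Unary addition, cut off at the end of the tape. -/
theorem run_times_right {s : State J σ α} {i t d : J} (hit : i ≠ t) (hid : i ≠ d) (htd : t ≠ d)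
    (hi : s.pos i ≤ N) (ht : s.pos t = 0) (hd : s.pos d ≤ N) :
    run N (times i t (right d)) s = s.setPos d (min (s.pos d + s.pos i) N) := by
  have h := run_times (N := N) hit (right d)
    (fun m => s.setPos d (min (s.pos d + (s.pos i - m)) N)) hi (by
      intro m hm
      have e : min (min (s.pos d + (s.pos i - (m + 1))) N + 1) N =
        min (s.pos d + (s.pos i - m)) N := by omega
      simp only [run_right, State.setPos_pos_of_ne _ _ htd.symm, State.setPos_pos_of_ne _ _ hid.symm,
        State.setPos_pos_self, e]
      rw [State.setPos_comm _ _ _ htd, State.setPos_comm _ _ _ hid, State.setPos_setPos])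
  simp only [Nat.sub_self, Nat.sub_zero, Nat.add_zero, min_eq_left hd] at h
  rw [State.setPos_eq_self (rfl : s.pos d = s.pos d), State.setPos_eq_self (rfl : s.pos i = _),
    State.setPos_eq_self ht] at h
  rw [h, State.setPos_comm _ _ _ hid.symm, State.setPos_eq_self (rfl : s.pos i = _),
    State.setPos_comm _ _ _ htd.symm, State.setPos_eq_self ht]

theorem run_times_left {s : State J σ α} {i t d : J} (hit : i ≠ t) (hid : i ≠ d) (htd : t ≠ d)
    (hi : s.pos i ≤ N) (ht : s.pos t = 0) :
    run N (times i t (left d)) s = s.setPos d (s.pos d - s.pos i) := by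
  have h := run_times (N := N) hit (left d)
    (fun m => s.setPos d (s.pos d - (s.pos i - m))) hi (by
      intro m hm
      have e : s.pos d - (s.pos i - (m + 1)) - 1 = s.pos d - (s.pos i - m) := by omega
      simp only [run_left, State.setPos_pos_of_ne _ _ htd.symm, State.setPos_pos_of_ne _ _ hid.symm,
        State.setPos_pos_self, e]
      rw [State.setPos_comm _ _ _ htd, State.setPos_comm _ _ _ hid, State.setPos_setPos])
  simp only [Nat.sub_self, Nat.sub_zero] at h
  rw [State.setPos_eq_self (rfl : s.pos d = s.pos d), State.setPos_eq_self (rfl : s.pos i = _),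
    State.setPos_eq_self ht] at h
  rw [h, State.setPos_comm _ _ _ hid.symm, State.setPos_eq_self (rfl : s.pos i = _),
    State.setPos_comm _ _ _ htd.symm, State.setPos_eq_self ht]

theorem run_forEach {j : J} (p : HeadProg J σ α) (S : ℕ → State J σ α)
    (h : ∀ m < N, run N p ((S m).setPos j m) = (S (m + 1)).setPos j m) :
    run N (forEach j p) ((S 0).setPos j 0) = (S N).setPos j 0 := by
  have h1 := iterate_countup (f := run N (seq p (right j))) (S := fun m => (S m).setPos j m)
    (N := N) (by
      intro m hm
      simp [run_seq, h m hm, run_right, min_eq_left (Nat.succ_le_of_lt hm)]) N le_rfl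
  rw [forEach, run_seq, run_rep, h1, run_rewind (by simp), State.setPos_setPos]

/-- For bodies that move a single head by a rule `g`; this applies to the searches for the nearest
chosen vertex. -/
theorem run_rep_setPos {j : J} {p : HeadProg J σ α} {g : ℕ → ℕ} (hg : ∀ k ≤ N, g k ≤ N)
    (s : State J σ α) (h : ∀ k ≤ N, run N p (s.setPos j k) = s.setPos j (g k))
    (hs : s.pos j ≤ N) : run N (rep p) s = s.setPos j (g^[N] (s.pos j)) := by
  have key : ∀ m, (run N p)^[m] s = s.setPos j (g^[m] (s.pos j)) ∧ g^[m] (s.pos j) ≤ N := by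
    intro m
    induction m with
    | zero => exact ⟨(State.setPos_eq_self rfl).symm, hs⟩
    | succ m ih =>
      rw [Function.iterate_succ_apply', Function.iterate_succ_apply', ih.1, h _ ih.2]
      exact ⟨rfl, hg _ ih.2⟩
  exact (key N).1

end HeadProg

/-! ## Tests on the input graph -/

namespace OrderedGraph

open HeadProg

/-- The registers of the program, which hold vertices. -/
inductive Reg
  | a
  | b
  | u
  | x
  | y
  deriving DecidableEq

instance : Fintype Reg :=
  ⟨{Reg.a, Reg.b, Reg.u, Reg.x, Reg.y}, by rintro (_ | _ | _ | _ | _) <;> simp⟩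

/-- The tapes of the program: the input, three counters, the marks on the literals, and the
registers. -/
inductive Tape
  | word
  | outer
  | inner
  | diff
  | mark (s : Bool)
  | reg (k : Reg)
  deriving DecidableEq, Fintype

/-- The finite memory of the program. -/
structure Flags where
  res : Bool
  prem : Bool
  bad : Bool
  ok : Bool
  cyc : Bool
  deriving Fintype

instance : Inhabited Letter := ⟨.entry false⟩

/-- Programs for the tapes and the memory above. -/
abbrev Program := HeadProg Tape Flags Letter

/-- States of programs for the tapes and the memory above. -/
abbrev Conf := HeadProg.State Tape Flags Letter

/-- Set the flag for the result of a test. -/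
def setRes (s : Conf) (r : Bool) : Conf := s.setMem { s.mem with res := r }

/-- The tapes hold the input and its vertices, and the heads other than those of the registers are
at rest. -/
structure Rest (w : List Letter) (s : Conf) : Prop where
  pos_word : s.pos .word = 0
  pos_outer : s.pos .outer = 0
  pos_inner : s.pos .inner = 0
  pos_diff : s.pos .diff = 0
  pos_mark : ∀ t, s.pos (.mark t) = 0
  pos_reg : ∀ k, s.pos (.reg k) ≤ w.length
  con_word : s.con .word = fun i => w.getD i default
  con_reg : ∀ k, s.con (.reg k) = vertexLetter w

variable {w : List Letter}

theorem Rest.setMem {s : Conf} (h : Rest w s) (v : Flags) : Rest w (s.setMem v) :=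
  ⟨h.1, h.2, h.3, h.4, h.5, h.6, h.7, h.8⟩

theorem Rest.setRes {s : Conf} (h : Rest w s) (r : Bool) : Rest w (setRes s r) := h.setMem _

theorem Rest.setPos {s : Conf} (h : Rest w s) (k : Reg) {i : ℕ} (hi : i ≤ w.length) :
    Rest w (s.setPos (.reg k) i) := by
  refine ⟨?_, ?_, ?_, ?_, fun t => ?_, fun k' => ?_, h.7, h.8⟩
  · rw [State.setPos_pos_of_ne _ _ (by simp)]; exact h.1
  · rw [State.setPos_pos_of_ne _ _ (by simp)]; exact h.2
  · rw [State.setPos_pos_of_ne _ _ (by simp)]; exact h.3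
  · rw [State.setPos_pos_of_ne _ _ (by simp)]; exact h.4
  · rw [State.setPos_pos_of_ne _ _ (by simp)]; exact h.5 t
  · by_cases hk : k' = k
    · subst hk
      rw [State.setPos_pos_self]
      exact hi
    · rw [State.setPos_pos_of_ne _ _ (by simpa using hk)]
      exact h.6 k'

/-- A program that computes a function of the head positions and the contents of the tapes, and
changes nothing but the flag for the result. -/
def Tests (w : List Letter) (c : Program) (f : (Tape → ℕ) → (Tape → ℕ → Letter) → Bool) : Prop :=
  ∀ s : Conf, Rest w s → run w.length c s = setRes s (f s.pos s.con)

/-- The comparison of two registers. -/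
def testLe (i j : Reg) : Program :=
  seq (times (.reg i) .outer (right .diff)) <|
    seq (times (.reg j) .outer (left .diff)) <|
      seq (load .diff fun v z _ => { v with res := z }) (rewind .diff)

/-- The truncated difference of the two positions is 0 exactly when the first is at most the second.
-/
theorem tests_testLe (i j : Reg) :
    Tests w (testLe i j) fun pos _ => decide (pos (.reg i) ≤ pos (.reg j)) := by
  intro s h
  have hi := h.pos_reg i
  have hj := h.pos_reg j
  rw [testLe, run_seq, run_times_right (by simp) (by simp) (by simp) hi h.pos_outer
    (by rw [h.pos_diff]; omega), h.pos_diff, Nat.zero_add, min_eq_left hi, run_seq,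
    run_times_left (by simp) (by simp) (by simp)
      (by rw [State.setPos_pos_of_ne _ _ (by simp)]; exact hj)
      (by rw [State.setPos_pos_of_ne _ _ (by simp)]; exact h.pos_outer),
    State.setPos_pos_self, State.setPos_pos_of_ne _ _ (by simp), State.setPos_setPos, run_seq,
    run_load, run_rewind (by simp; omega)]
  rw [State.setMem_setPos, State.setPos_setPos, State.setPos_eq_self h.pos_diff]
  simp [setRes, State.atStart, Nat.sub_eq_zero_iff_le]

/-- Reading the entry of the vertices in two registers. -/
def readEntry (i j : Reg) : Program :=
  seq (times (.reg i) .outer (seq (right .word) (times (.reg i) .inner (right .word)))) <|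
    seq (right .word) <|
      seq (times (.reg j) .outer (right .word)) <|
        seq (load .word fun v _ o => { v with res := decide (o = some (.entry true)) })
          (rewind .word)

/-- A head stopped at the end reads no letter, just as looking up a position past the end does, so
truncation is harmless. -/
theorem read_word {s : Conf} (h : s.con .word = fun i => w.getD i default) {k : ℕ}
    (hk : s.pos .word = min k w.length) : s.read w.length .word = w[k]? := by
  rw [State.read, hk, h]
  rcases lt_or_ge k w.length with hkw | hkw
  · rw [min_eq_left hkw.le, if_pos hkw]
    simp [hkw]
  · rw [min_eq_right hkw, if_neg (lt_irrefl _)]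
    simp [hkw]

theorem tests_readEntry (i j : Reg) :
    Tests w (readEntry i j) fun pos _ =>
      decide (w[tri (pos (.reg i)) + 1 + pos (.reg j)]? = some (.entry true)) := by
  intro s h
  have hi := h.pos_reg i
  have hj := h.pos_reg j
  have h1 := run_times (N := w.length) (i := Tape.reg i) (t := .outer) (by simp)
    (seq (right .word) (times (.reg i) .inner (right .word)))
    (fun m => s.setPos .word (min (tri (s.pos (.reg i)) - tri m) w.length)) hi (by
      intro m hm
      rw [run_seq, run_right, run_times_right (by simp) (by simp) (by simp)
        (by simp [State.setPos_pos]; omega) (by simp [State.setPos_pos, h.pos_inner]) (by simp)]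
      -- With the register at `m`, the round moves the word head by `1 + m`, which is `tri (m + 1) -
      -- tri m`; over all rounds this amounts to `tri` of the register.
      have e : min (min (min (tri (s.pos (.reg i)) - tri (m + 1)) w.length + 1) w.length + m)
          w.length = min (tri (s.pos (.reg i)) - tri m) w.length := by
        have := tri_mono (Nat.succ_le_of_lt hm)
        simp only [tri] at this ⊢
        omega
      simp only [State.setPos_pos, reduceCtorEq, if_true, if_false, e, State.setPos_setPos]
      rw [State.setPos_comm (i := Tape.outer) (j := .word) _ _ _ (by simp),
        State.setPos_comm (i := Tape.reg i) (j := .word) _ _ _ (by simp), State.setPos_setPos])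
  simp only [Nat.sub_self, Nat.zero_min] at h1
  rw [State.setPos_eq_self h.pos_word, State.setPos_eq_self (rfl : s.pos (.reg i) = _),
    State.setPos_eq_self h.pos_outer] at h1
  have e0 : tri (s.pos (.reg i)) - tri 0 = tri (s.pos (.reg i)) := rfl
  have h2 : ((s.setPos .word (min (tri (s.pos (.reg i)) - tri 0) w.length)).setPos (.reg i)
      (s.pos (.reg i))).setPos .outer 0 =
      s.setPos .word (min (tri (s.pos (.reg i))) w.length) := by
    rw [State.setPos_eq_self (k := s.pos (.reg i)) (by simp [State.setPos_pos]),
      State.setPos_eq_self (by simp [State.setPos_pos, h.pos_outer]), e0]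
  rw [readEntry, run_seq, h1, h2, run_seq, run_right, State.setPos_setPos, State.setPos_pos_self,
    run_seq, run_times_right (by simp) (by simp) (by simp)
      (by simpa [State.setPos_pos] using hj) (by simp [State.setPos_pos, h.pos_outer]) (by simp),
    State.setPos_setPos, run_seq, run_load, read_word (k := tri (s.pos (.reg i)) + 1 + s.pos (.reg j))
      (by simpa using h.con_word) (by simp [State.setPos_pos]; omega),
    run_rewind (by simp), State.setMem_setPos, State.setPos_setPos, State.setPos_eq_self h.pos_word]
  rfl

end OrderedGraph

/-! ### Adjacency, conflicts, clashes and marks. -/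

namespace OrderedGraph

open HeadProg

variable {w : List Letter}

/-- Is `i` a vertex of the graph described by the word? -/
def isVertex (w : List Letter) (i : ℕ) : Bool := vertexLetter w i matches .vertex _

/-- Is `i` a chosen vertex of the graph described by the word? -/
def isChosen (w : List Letter) (i : ℕ) : Bool := decide (vertexLetter w i = .vertex true)

/-- Are `i` and `j` adjacent in the graph described by the word? -/
def areAdj (w : List Letter) (i j : ℕ) : Bool := entryAt w i j || entryAt w j i

theorem vertexLetter_of_le {i : ℕ} (h : w.length ≤ i) : vertexLetter w i = .entry false := by
  rw [vertexLetter, List.getD_eq_default]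
  exact (List.length_filter_le _ _).trans h

theorem Rest.read_reg_eq {s : Conf} (h : Rest w s) (k : Reg) :
    decide (s.read w.length (.reg k) = some (.vertex true)) = isChosen w (s.pos (.reg k)) := by
  rw [State.read, h.con_reg, isChosen]
  split_ifs with hk
  · simp
  · simp [vertexLetter_of_le (not_lt.1 hk)]

/-- Does a letter open a vertex? -/
def holdsVertex : Option Letter → Bool
  | some (.vertex _) => true
  | _ => false

theorem Rest.holdsVertex_read {s : Conf} (h : Rest w s) (k : Reg) :
    holdsVertex (s.read w.length (.reg k)) = isVertex w (s.pos (.reg k)) := by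
  rw [State.read, h.con_reg, isVertex]
  split_ifs with hk
  · cases vertexLetter w (s.pos (.reg k)) <;> rfl
  · rw [vertexLetter_of_le (not_lt.1 hk)]
    rfl

/-- Branch on the result of a test. -/
def iteRes (p q : Program) : Program := ite .word (fun v _ _ => v.res) p q

theorem run_iteRes (N : ℕ) (p q : Program) (s : Conf) (r : Bool) :
    run N (iteRes p q) (setRes s r) =
      if r then run N p (setRes s r) else run N q (setRes s r) := rfl

section Tests

variable {c c' : Program} {f f' : (Tape → ℕ) → (Tape → ℕ → Letter) → Bool}

/-- A test alters only the result flag, so the second one sees the same positions and contents as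
the first. -/
theorem Tests.or (h : Tests w c f) (h' : Tests w c' f') :
    Tests w (seq c (iteRes (skip .word) c')) fun pos con => f pos con || f' pos con := by
  intro s hs
  rw [run_seq, h s hs, run_iteRes]
  cases hf : f s.pos s.con
  · simp only [Bool.false_eq_true, if_false, hf]
    exact h' _ (hs.setRes _)
  · simp only [if_true, hf]
    rfl

theorem Tests.notAnd (h : Tests w c f) (h' : Tests w c' f') :
    Tests w (seq c (iteRes (load .word fun v _ _ => { v with res := false }) c'))
      fun pos con => !f pos con && f' pos con := by
  intro s hs
  rw [run_seq, h s hs, run_iteRes]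
  cases hf : f s.pos s.con
  · simp only [Bool.false_eq_true, if_false, hf]
    exact h' _ (hs.setRes _)
  · simp only [if_true, hf]
    rfl

/-- Record in a flag if the result of a test is positive and that of another one is negative. -/
def recordUnless (c c' : Program) : Program :=
  seq c <| seq (load .word fun v _ _ => { v with prem := v.res }) <|
    seq c' <| load .word fun v _ _ =>
      { v with res := false, prem := false, bad := v.bad || (v.prem && !v.res) }

theorem run_recordUnless (h : Tests w c f) (h' : Tests w c' f') {s : Conf} (hs : Rest w s) :
    run w.length (recordUnless c c') s = s.setMem { s.mem with
      res := false, prem := false, bad := s.mem.bad || (f s.pos s.con && !f' s.pos s.con) } := by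
  rw [recordUnless, run_seq, h s hs, run_seq, run_load, run_seq, h' _ ((hs.setRes _).setMem _), run_load]
  rfl

end Tests

/-- The adjacency of the vertices in two registers. -/
def testAdj (i j : Reg) : Program :=
  seq (seq (testLe i j) (iteRes (load .word fun v _ _ => { v with res := false }) (readEntry i j)))
    (iteRes (skip .word) (seq (testLe j i)
      (iteRes (load .word fun v _ _ => { v with res := false }) (readEntry j i))))

/-- The word holds only entries below the diagonal, so each order of the two registers is tried,
guarded by a strict comparison. -/
theorem tests_testAdj (i j : Reg) :
    Tests w (testAdj i j) fun pos _ => areAdj w (pos (.reg i)) (pos (.reg j)) := by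
  have h := ((tests_testLe (w := w) i j).notAnd (tests_readEntry i j)).or
    ((tests_testLe j i).notAnd (tests_readEntry j i))
  intro s hs
  rw [testAdj, h s hs]
  have e : ∀ m n : ℕ, (!decide (m ≤ n)) = decide (n < m) := fun m n => by
    rw [← decide_not]
    simp only [not_le]
  simp only [areAdj, entryAt, e]

/-- The conflict of the images in `k` and `l` for the vertices in `i` and `j`. -/
def testConflict (i k j l : Reg) : Program :=
  seq (load (.reg k) fun v _ o =>
      { v with res := false, prem := false, bad := !decide (o = some (.vertex true)) }) <|
    seq (load (.reg l) fun v _ o =>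
        { v with bad := v.bad || !decide (o = some (.vertex true)) }) <|
      seq (recordUnless (testAdj i j) (testAdj k l)) <|
        seq (recordUnless (testLe i j) (testLe k l)) <|
          seq (recordUnless (testLe j i) (testLe l k)) <|
            load .word fun v _ _ => { v with res := v.bad, bad := false }

theorem run_testConflict (i k j l : Reg) {s : Conf} (hs : Rest w s) :
    run w.length (testConflict i k j l) s = s.setMem { s.mem with
      res := conflict (isChosen w) (areAdj w) (s.pos (.reg i)) (s.pos (.reg k)) (s.pos (.reg j))
        (s.pos (.reg l))
      prem := false
      bad := false } := by
  rw [testConflict, run_seq, run_load, hs.read_reg_eq, run_seq, run_load,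
    (hs.setMem _).read_reg_eq, run_seq,
    run_recordUnless (tests_testAdj i j) (tests_testAdj k l) ((hs.setMem _).setMem _), run_seq,
    run_recordUnless (tests_testLe i j) (tests_testLe k l) (((hs.setMem _).setMem _).setMem _), run_seq,
    run_recordUnless (tests_testLe j i) (tests_testLe l k)
      ((((hs.setMem _).setMem _).setMem _).setMem _), run_load]
  rfl

/-- Copy the contents of a register to one that is at the beginning. -/
def copy (i j : Reg) : Program := times (.reg i) .outer (right (.reg j))

theorem run_copy {i j : Reg} (hij : i ≠ j) {s : Conf} (hs : Rest w s) (hj : s.pos (.reg j) = 0) :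
    run w.length (copy i j) s = s.setPos (.reg j) (s.pos (.reg i)) := by
  have hi := hs.pos_reg i
  rw [copy, run_times_right (by simp) (by simpa using hij) (by simp) hi hs.pos_outer (by omega),
    hj, Nat.zero_add, min_eq_left hi]

/-- Move a register to the nearest chosen vertex. -/
def moveNearest (j : Reg) : Bool → Program
  | false => seq
    (rep (ite (.reg j) (fun _ _ o => decide (o = some (.vertex true))) (skip .word)
      (left (.reg j))))
    (rep (ite (.reg j) (fun _ _ o => decide (o = some (.vertex true))) (skip .word)
      (right (.reg j))))
  | true => seq
    (rep (ite (.reg j) (fun _ _ o => decide (o = some (.vertex true))) (skip .word)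
      (right (.reg j))))
    (rep (ite (.reg j) (fun _ _ o => decide (o = some (.vertex true))) (skip .word)
      (left (.reg j))))

theorem down_le (P : ℕ → Bool) {N k : ℕ} (h : k ≤ N) : down P k ≤ N := by
  rw [down]; split_ifs <;> omega

theorem up_le (P : ℕ → Bool) {N k : ℕ} (h : k ≤ N) : up N P k ≤ N := by
  rw [up]; split_ifs <;> omega

theorem run_moveNearest (j : Reg) (t : Bool) {s : Conf} (hs : Rest w s) :
    run w.length (moveNearest j t) s =
      s.setPos (.reg j) (nearest w.length (isChosen w) t (s.pos (.reg j))) := by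
  have hdown : ∀ s : Conf, Rest w s → run w.length (rep (ite (.reg j)
      (fun _ _ o => decide (o = some (.vertex true))) (skip .word) (left (.reg j)))) s =
      s.setPos (.reg j) ((down (isChosen w))^[w.length] (s.pos (.reg j))) := by
    intro s hs
    refine run_rep_setPos (fun k hk => down_le _ hk) s (fun k hk => ?_) (hs.pos_reg j)
    rw [run_ite, (hs.setPos j hk).read_reg_eq, State.setPos_pos_self, down]
    split_ifs
    · rfl
    · rw [run_left, State.setPos_pos_self, State.setPos_setPos]
  have hup : ∀ s : Conf, Rest w s → run w.length (rep (ite (.reg j)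
      (fun _ _ o => decide (o = some (.vertex true))) (skip .word) (right (.reg j)))) s =
      s.setPos (.reg j) ((up w.length (isChosen w))^[w.length] (s.pos (.reg j))) := by
    intro s hs
    refine run_rep_setPos (fun k hk => up_le _ hk) s (fun k hk => ?_) (hs.pos_reg j)
    rw [run_ite, (hs.setPos j hk).read_reg_eq, State.setPos_pos_self, up]
    split_ifs
    · rfl
    · rw [run_right, State.setPos_pos_self, State.setPos_setPos]
  have hj := hs.pos_reg j
  cases t
  · have h1 := (down_iterate (P := isChosen w) (s.pos (.reg j)) w.length).1
    rw [moveNearest, run_seq, hdown s hs, hup _ (hs.setPos j (h1.trans hj)), State.setPos_setPos,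
      State.setPos_pos_self]
    rfl
  · have h1 := (up_iterate (P := isChosen w) (s.pos (.reg j)) w.length hj).2.1
    rw [moveNearest, run_seq, hup s hs, hdown _ (hs.setPos j h1), State.setPos_setPos,
      State.setPos_pos_self]
    rfl

theorem nearest_le (P : ℕ → Bool) {N k : ℕ} (h : k ≤ N) (t : Bool) : nearest N P t k ≤ N := by
  cases t
  · exact (up_iterate _ N ((down_iterate k N).1.trans h)).2.1
  · exact (down_iterate _ N).1.trans (up_iterate k N h).2.1

/-- The clash of the literals for the vertices in `a` and `b`. -/
def testClash (t t' : Bool) : Program :=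
  seq (copy .a .x) <| seq (moveNearest .x t) <| seq (copy .b .y) <| seq (moveNearest .y t') <|
    seq (testConflict .a .x .b .y) <| seq (rewind (.reg .x)) (rewind (.reg .y))

/-- The registers `x` and `y` are scratch space for the two images and return to 0, so the test can
be repeated. -/
theorem run_testClash (t t' : Bool) {s : Conf} (hs : Rest w s) (hx : s.pos (.reg .x) = 0)
    (hy : s.pos (.reg .y) = 0) :
    run w.length (testClash t t') s = s.setMem { s.mem with
      res := clash w.length (isChosen w) (areAdj w) (s.pos (.reg .a), t) (s.pos (.reg .b), t')
      prem := false
      bad := false } := by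
  have ha := hs.pos_reg .a
  have hb := hs.pos_reg .b
  have hxn := nearest_le (isChosen w) ha t
  have hyn := nearest_le (isChosen w) hb t'
  rw [testClash, run_seq, run_copy (by simp) hs hx, run_seq,
    run_moveNearest _ _ (hs.setPos .x ha), State.setPos_setPos, State.setPos_pos_self, run_seq,
    run_copy (by simp) (hs.setPos .x hxn) (by simpa [State.setPos_pos] using hy)]
  rw [State.setPos_pos_of_ne (i := Tape.reg .b) _ _ (by simp), run_seq,
    run_moveNearest _ _ ((hs.setPos .x hxn).setPos .y hb), State.setPos_setPos,
    State.setPos_pos_self, run_seq, run_testConflict _ _ _ _ ((hs.setPos .x hxn).setPos .y hyn),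
    run_seq, run_rewind (j := Tape.reg .x) (by simpa [State.setPos_pos] using hxn),
    run_rewind (by simpa [State.setPos_pos] using hyn)]
  rw [State.setMem_setPos, State.setMem_setPos,
    State.setPos_comm (i := Tape.reg .x) (j := Tape.reg .y) _ _ _ (by simp),
    State.setPos_setPos, State.setPos_comm (i := Tape.reg .y) (j := Tape.reg .x) _ _ _ (by simp),
    State.setPos_setPos, State.setPos_eq_self (k := 0)
      (by simp [State.setPos_pos, hy]), State.setPos_eq_self hx]
  simp [State.setPos_pos, clash]

/-- Is the literal for the vertex in a register marked? -/
def testMark (k : Reg) (t : Bool) : Program :=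
  seq (times (.reg k) .outer (right (.mark t))) <|
    seq (load (.mark t) fun v _ o => { v with res := decide (o = some (.vertex true)) })
      (rewind (.mark t))

theorem tests_testMark (k : Reg) (t : Bool) : Tests w (testMark k t) fun pos con =>
    decide (pos (.reg k) < w.length) && decide (con (.mark t) (pos (.reg k)) = .vertex true) := by
  intro s hs
  have hk := hs.pos_reg k
  rw [testMark, run_seq, run_times_right (by simp) (by simp) (by simp) hk hs.pos_outer
    (by rw [hs.pos_mark]; omega), hs.pos_mark, Nat.zero_add, min_eq_left hk, run_seq, run_load,
    run_rewind (by simpa using hk), State.setMem_setPos, State.setPos_setPos,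
    State.setPos_eq_self (hs.pos_mark t)]
  simp only [setRes, State.read, State.setPos_pos_self, State.setPos_con, State.setPos_mem]
  congr 2
  split_ifs with h <;> simp [h]

/-- Change the contents of a tape. -/
def setCon (s : Conf) (j : Tape) (c : ℕ → Letter) : Conf :=
  { s with con := Function.update s.con j c }

/-- Mark the literal for the vertex in a register. -/
def setMark (k : Reg) (t : Bool) : Program :=
  seq (times (.reg k) .outer (right (.mark t))) <|
    seq (write (.mark t) fun _ => .vertex true) (rewind (.mark t))

theorem run_setMark (k : Reg) (t : Bool) {s : Conf} (hs : Rest w s)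
    (hk : s.pos (.reg k) < w.length) : run w.length (setMark k t) s =
      setCon s (.mark t)
        (Function.update (s.con (.mark t)) (s.pos (.reg k)) (.vertex true)) := by
  rw [setMark, run_seq, run_times_right (by simp) (by simp) (by simp) hk.le hs.pos_outer
    (by rw [hs.pos_mark]; omega), hs.pos_mark, Nat.zero_add, min_eq_left hk.le, run_seq]
  have e : run w.length (write (.mark t) fun _ => Letter.vertex true)
      (s.setPos (.mark t) (s.pos (.reg k))) =
      State.setPos (setCon s (.mark t)
        (Function.update (s.con (.mark t)) (s.pos (.reg k)) (.vertex true))) (.mark t)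
          (s.pos (.reg k)) := by
    simp only [run, State.setPos_pos_self, hk, if_true]
    rfl
  rw [e, run_rewind (by simpa using hk.le), State.setPos_setPos]
  exact State.setPos_eq_self (hs.pos_mark t)

/-- Remove all marks of one sign. -/
def clearMarks (t : Bool) : Program := forEach (.mark t) (write (.mark t) fun _ => .entry false)

/-- Contents are functions on all of `ℕ`; cells past the end of the tape cannot be reached and keep
their values. -/
theorem run_clearMarks (t : Bool) {s : Conf} (hs : Rest w s) : run w.length (clearMarks t) s =
    setCon s (.mark t)
      fun i => if i < w.length then .entry false else s.con (.mark t) i := by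
  have h := run_forEach (N := w.length) (j := Tape.mark t)
    (write (.mark t) fun _ => Letter.entry false) (fun m => setCon s (.mark t)
      fun i => if i < m then .entry false else s.con (.mark t) i) (by
    intro m hm
    simp only [run, setCon, State.setPos_pos_self, hm, if_true, State.setPos_con, Function.update_self,
      Function.update_idem]
    refine State.ext rfl rfl ?_
    simp only [State.setPos_con]
    congr 1
    funext i
    rw [Function.update_apply]
    split_ifs <;> first | rfl | omega)
  have e : setCon s (.mark t)
      (fun i => if i < 0 then .entry false else s.con (.mark t) i) = s := by simp [setCon]
  rw [e, State.setPos_eq_self (hs.pos_mark t)] at h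
  rw [clearMarks, h]
  exact State.setPos_eq_self (hs.pos_mark t)

end OrderedGraph

/-! ## The decision procedure -/

namespace OrderedGraph

open HeadProg

/-- The contents of the tapes with the marks. -/
abbrev Marks := Bool → ℕ → Letter

/-- Is the literal marked? -/
def marked (M : Marks) (x : ℕ × Bool) : Bool := decide (M x.2 x.1 = .vertex true)

/-- Mark a literal. -/
def addMark (M : Marks) (x : ℕ × Bool) : Marks :=
  Function.update M x.2 (Function.update (M x.2) x.1 (.vertex true))

/-- Remove all marks. -/
def noMarks (N : ℕ) (M : Marks) : Marks := fun t i => if i < N then .entry false else M t i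

variable (w : List Letter)

/-- The clash of literals in the graph described by the word. -/
def wordClash (x y : ℕ × Bool) : Bool := clash w.length (isChosen w) (areAdj w) x y

/-- Mark `y` if `x` is marked and `y` follows from `x`. -/
def relaxMarks (M : Marks) (x y : ℕ × Bool) : Marks :=
  if marked M x && wordClash w x (TwoSat.neg y) then addMark M y else M

/-- Propagate the marks from one vertex to another. -/
def relaxVertices (M : Marks) (a b : ℕ) : Marks :=
  [(false, false), (false, true), (true, false), (true, true)].foldl
    (fun M t => relaxMarks w M (a, t.1) (b, t.2)) M

/-- Propagate the marks from one vertex to all. -/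
def relaxVertex (M : Marks) (a : ℕ) : Marks :=
  (List.range w.length).foldl (fun M b => if isVertex w b then relaxVertices w M a b else M) M

/-- Propagate all marks once. -/
def sweepMarks (M : Marks) : Marks :=
  (List.range w.length).foldl (fun M a => if isVertex w a then relaxVertex w M a else M) M

/-- Mark what follows from a literal. -/
def closureMarks (x : ℕ × Bool) (M : Marks) : Marks :=
  ((sweepMarks w)^[2])^[w.length] (addMark (noMarks w.length M) x)

/-- Check that a literal for the vertex `u` is not equivalent to its opposite. -/
def checkVertex (s : Bool × Marks) (u : ℕ) : Bool × Marks :=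
  if isVertex w u then
    (s.1 && !(marked (closureMarks w (u, false) s.2) (u, true) &&
        marked (closureMarks w (u, true) (closureMarks w (u, false) s.2)) (u, false)),
      closureMarks w (u, true) (closureMarks w (u, false) s.2))
  else s

/-- The state of the program between tests. -/
def conf (ok cyc : Bool) (a b u : ℕ) (M : Marks) : Conf where
  mem := ⟨false, false, false, ok, cyc⟩
  pos
    | .reg .a => a
    | .reg .b => b
    | .reg .u => u
    | _ => 0
  con
    | .mark t => M t
    | .reg _ => vertexLetter w
    | _ => fun i => w.getD i default

variable {w} {ok cyc : Bool} {a b u : ℕ} {M : Marks}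

theorem rest_conf (ha : a ≤ w.length) (hb : b ≤ w.length) (hu : u ≤ w.length) :
    Rest w (conf w ok cyc a b u M) := by
  refine ⟨rfl, rfl, rfl, rfl, fun _ => rfl, fun k => ?_, rfl, fun _ => rfl⟩
  cases k
  exacts [ha, hb, hu, Nat.zero_le _, Nat.zero_le _]

theorem conf_setPos_a (k : ℕ) :
    (conf w ok cyc a b u M).setPos (.reg .a) k = conf w ok cyc k b u M := by
  refine State.ext rfl (funext fun t => ?_) rfl
  rw [State.setPos_pos]
  rcases t with _ | _ | _ | _ | _ | (_ | _ | _ | _ | _) <;> simp [conf]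

theorem conf_setPos_b (k : ℕ) :
    (conf w ok cyc a b u M).setPos (.reg .b) k = conf w ok cyc a k u M := by
  refine State.ext rfl (funext fun t => ?_) rfl
  rw [State.setPos_pos]
  rcases t with _ | _ | _ | _ | _ | (_ | _ | _ | _ | _) <;> simp [conf]

theorem conf_setPos_u (k : ℕ) :
    (conf w ok cyc a b u M).setPos (.reg .u) k = conf w ok cyc a b k M := by
  refine State.ext rfl (funext fun t => ?_) rfl
  rw [State.setPos_pos]
  rcases t with _ | _ | _ | _ | _ | (_ | _ | _ | _ | _) <;> simp [conf]

theorem setCon_conf (t : Bool) (c : ℕ → Letter) :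
    setCon (conf w ok cyc a b u M) (.mark t) c =
      conf w ok cyc a b u (Function.update M t c) := by
  refine State.ext rfl rfl (funext fun j => ?_)
  simp only [setCon, conf, Function.update_apply]
  rcases j with _ | _ | _ | _ | t' | _ <;> simp

/-- The program for marking a literal for `b` if it follows from a marked literal for `a`. -/
def relax (t t' : Bool) : Program :=
  seq (testMark .a t) <| iteRes
    (seq (testClash t !t') <| iteRes
      (seq (load .word fun v _ _ => { v with res := false }) (setMark .b t')) (skip .word))
    (skip .word)

theorem run_setMark_conf_b (hb : b < w.length) (ha : a ≤ w.length) (hu : u ≤ w.length) (t : Bool) :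
    run w.length (setMark .b t) (conf w ok cyc a b u M) =
      conf w ok cyc a b u (addMark M (b, t)) := by
  rw [run_setMark .b t (rest_conf ha hb.le hu) hb, setCon_conf]
  rfl

theorem run_setMark_conf_u (hu : u < w.length) (ha : a ≤ w.length) (hb : b ≤ w.length) (t : Bool) :
    run w.length (setMark .u t) (conf w ok cyc a b u M) =
      conf w ok cyc a b u (addMark M (u, t)) := by
  rw [run_setMark .u t (rest_conf ha hb hu.le) hu, setCon_conf]
  rfl

theorem run_relax (ha : a < w.length) (hb : b < w.length) (hu : u ≤ w.length) (t t' : Bool) :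
    run w.length (relax t t') (conf w ok cyc a b u M) =
      conf w ok cyc a b u (relaxMarks w M (a, t) (b, t')) := by
  have hs := rest_conf (ok := ok) (cyc := cyc) (M := M) ha.le hb.le hu
  have e : (decide ((conf w ok cyc a b u M).pos (.reg .a) < w.length) &&
      decide ((conf w ok cyc a b u M).con (.mark t) ((conf w ok cyc a b u M).pos (.reg .a)) =
        .vertex true)) = marked M (a, t) := by
    simp [conf, ha, marked]
  rw [relax, run_seq, tests_testMark _ _ _ hs]
  beta_reduce
  rw [e, run_iteRes, relaxMarks]
  cases h : marked M (a, t)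
  · rfl
  · simp only [if_true]
    rw [run_seq, run_testClash _ _ (hs.setRes _) rfl rfl]
    have e2 : State.setMem (setRes (conf w ok cyc a b u M) true)
        { (setRes (conf w ok cyc a b u M) true).mem with
          res := clash w.length (isChosen w) (areAdj w)
            ((setRes (conf w ok cyc a b u M) true).pos (.reg .a), t)
            ((setRes (conf w ok cyc a b u M) true).pos (.reg .b), !t')
          prem := false
          bad := false } =
        setRes (conf w ok cyc a b u M) (wordClash w (a, t) (TwoSat.neg (b, t'))) := rfl
    rw [e2, run_iteRes, Bool.true_and]
    cases wordClash w (a, t) (TwoSat.neg (b, t'))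
    · rfl
    · exact run_setMark_conf_b hb ha.le hu t'

/-- Propagate the marks from the vertex in `a` to the one in `b`. -/
def relaxAll : Program :=
  seq (relax false false) <| seq (relax false true) <| seq (relax true false) (relax true true)

theorem run_relaxAll (ha : a < w.length) (hb : b < w.length) (hu : u ≤ w.length) :
    run w.length relaxAll (conf w ok cyc a b u M) =
      conf w ok cyc a b u (relaxVertices w M a b) := by
  simp only [relaxAll, run_seq, run_relax ha hb hu]
  rfl

/-- Execute a program if there is a vertex in a register. -/
def onVertex (k : Reg) (p : Program) : Program :=
  ite (.reg k) (fun _ _ o => holdsVertex o) p (skip .word)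

theorem run_onVertex (k : Reg) (p : Program) {s : Conf} (hs : Rest w s) :
    run w.length (onVertex k p) s =
      if isVertex w (s.pos (.reg k)) then run w.length p s else s := by
  rw [onVertex, run_ite, hs.holdsVertex_read]
  rfl

/-- Turns a loop over head positions into a fold on abstract data, with `C` translating the data
into states. -/
theorem run_forEach_foldl {N : ℕ} {β : Type*} {j : Tape} {p : Program} (C : β → Conf)
    (f : β → ℕ → β)
    (h : ∀ x, ∀ m < N, run N p ((C x).setPos j m) = (C (f x m)).setPos j m) (x : β) :
    run N (forEach j p) ((C x).setPos j 0) = (C ((List.range N).foldl f x)).setPos j 0 := by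
  refine run_forEach p (fun m => C ((List.range m).foldl f x)) fun m hm => ?_
  rw [h _ m hm, List.range_succ, List.foldl_append]
  rfl

/-- Propagate all marks once. -/
def sweep : Program := forEach (.reg .a) (onVertex .a (forEach (.reg .b) (onVertex .b relaxAll)))

theorem run_sweep (hu : u ≤ w.length) : run w.length sweep (conf w ok cyc 0 0 u M) =
    conf w ok cyc 0 0 u (sweepMarks w M) := by
  have h := run_forEach_foldl (N := w.length) (j := Tape.reg .a)
    (p := onVertex .a (forEach (.reg .b) (onVertex .b relaxAll)))
    (fun M => conf w ok cyc 0 0 u M)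
    (fun M a => if isVertex w a then relaxVertex w M a else M) (by
      intro M a ha
      rw [conf_setPos_a, conf_setPos_a, run_onVertex _ _ (rest_conf ha.le (Nat.zero_le _) hu)]
      change (if isVertex w a = true then _ else _) = _
      split_ifs
      · have h := run_forEach_foldl (N := w.length) (j := Tape.reg .b)
          (p := onVertex .b relaxAll) (fun M => conf w ok cyc a 0 u M)
          (fun M b => if isVertex w b then relaxVertices w M a b else M) (by
            intro M b hb
            rw [conf_setPos_b, conf_setPos_b, run_onVertex _ _ (rest_conf ha.le hb.le hu)]
            change (if isVertex w b = true then _ else _) = _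
            split_ifs
            · exact run_relaxAll ha hb hu
            · rfl) M
        rw [conf_setPos_b, conf_setPos_b] at h
        exact h
      · rfl) M
  rw [conf_setPos_a, conf_setPos_a] at h
  exact h

/-- Mark what follows from a literal for the vertex in `u`. -/
def closure (t : Bool) : Program :=
  seq (clearMarks false) <| seq (clearMarks true) <| seq (setMark .u t) <|
    rep (seq sweep sweep)

theorem run_closure (hu : u < w.length) (t : Bool) :
    run w.length (closure t) (conf w ok cyc 0 0 u M) =
      conf w ok cyc 0 0 u (closureMarks w (u, t) M) := by
  have hr : ∀ M, Rest w (conf w ok cyc 0 0 u M) := fun M =>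
    rest_conf (Nat.zero_le _) (Nat.zero_le _) hu.le
  have e : Function.update (Function.update M false
      fun i => if i < w.length then Letter.entry false else M false i) true
      (fun i => if i < w.length then Letter.entry false else M true i) = noMarks w.length M := by
    funext s
    cases s <;> rfl
  have hrep : ∀ k M, (run w.length (seq sweep sweep))^[k] (conf w ok cyc 0 0 u M) =
      conf w ok cyc 0 0 u (((sweepMarks w)^[2])^[k] M) := by
    intro k
    induction k with
    | zero => exact fun _ => rfl
    | succ k ih =>
      intro M
      rw [Function.iterate_succ_apply, Function.iterate_succ_apply, run_seq,
        run_sweep hu.le, run_sweep hu.le, ih]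
      rfl
  rw [closure, run_seq, run_clearMarks _ (hr M), setCon_conf, run_seq, run_clearMarks _ (hr _),
    setCon_conf, run_seq]
  change run _ _ (run _ _ (conf w ok cyc 0 0 u (Function.update (Function.update M false
      fun i => if i < w.length then Letter.entry false else M false i) true
      (fun i => if i < w.length then Letter.entry false else M true i)))) = _
  rw [e, run_setMark_conf_u hu (Nat.zero_le _) (Nat.zero_le _), run_rep, hrep]
  rfl

/-- Check that no literal is equivalent to its opposite. -/
def searchCycle : Program :=
  forEach (.reg .u) <| onVertex .u <| seq (closure false) <| seq (testMark .u true) <|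
    seq (load .word fun v _ _ => { v with res := false, cyc := v.res }) <|
      seq (closure true) <| seq (testMark .u false) <|
        load .word fun v _ _ => { v with res := false, cyc := false, ok := v.ok && !(v.cyc && v.res) }

theorem run_searchCycle : run w.length searchCycle (conf w ok false 0 0 0 M) =
    conf w ((List.range w.length).foldl (checkVertex w) (ok, M)).1 false 0 0 0
      ((List.range w.length).foldl (checkVertex w) (ok, M)).2 := by
  have h := run_forEach_foldl (N := w.length) (j := Tape.reg .u)
    (fun s : Bool × Marks => conf w s.1 false 0 0 0 s.2) (checkVertex w)
    (p := onVertex .u <| seq (closure false) <| seq (testMark .u true) <|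
      seq (load .word fun v _ _ => { v with res := false, cyc := v.res }) <|
      seq (closure true) <| seq (testMark .u false) <|
        load .word fun v _ _ =>
          { v with res := false, cyc := false, ok := v.ok && !(v.cyc && v.res) }) (by
      rintro ⟨ok, M⟩ u hu
      have hr : ∀ cyc M, Rest w (conf w ok cyc 0 0 u M) := fun cyc M =>
        rest_conf (Nat.zero_le _) (Nat.zero_le _) hu.le
      have ht : ∀ cyc M t, run w.length (testMark .u t) (conf w ok cyc 0 0 u M) =
          setRes (conf w ok cyc 0 0 u M) (marked M (u, t)) := by
        intro cyc M t
        rw [tests_testMark _ _ _ (hr cyc M)]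
        simp [conf, hu, marked]
      simp only [conf_setPos_u]
      rw [run_onVertex _ _ (hr _ _), checkVertex]
      change (if isVertex w u = true then _ else _) = _
      split_ifs
      · rw [run_seq, run_closure hu, run_seq, ht, run_seq, run_load]
        change run _ _ (conf w ok (marked (closureMarks w (u, false) M) (u, true)) 0 0 u
          (closureMarks w (u, false) M)) = _
        rw [run_seq, run_closure hu, run_seq, ht, run_load]
        rfl
      · rfl) (ok, M)
  simp only [conf_setPos_u] at h
  exact h

end OrderedGraph

/-! ## Checking the form of the input and reading its vertices -/

namespace OrderedGraph

open HeadProg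

variable {w : List Letter} {ok cyc : Bool} {a b u : ℕ} {M : Marks}

theorem read_setPos_word {s : Conf} (h : s.con .word = fun i => w.getD i default) {m : ℕ}
    (hm : m < w.length) : (s.setPos .word m).read w.length .word = some w[m] := by
  rw [read_word (w := w) (k := m) (by simpa using h) (by simp [hm.le])]
  simp [hm]

/-- Append a letter to a register if it is the letter of the input that is read. -/
def appendIf (k : Reg) (x : Letter) : Program :=
  ite .word (fun _ _ o => decide (o = some x))
    (seq (write (.reg k) fun _ => x) (right (.reg k))) (skip .word)

/-- Write the letters that open a vertex to a register. -/
def loadVertices (k : Reg) : Program :=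
  seq (forEach (.reg k) (write (.reg k) fun _ => .entry false)) <|
    seq (forEach .word (seq (appendIf k (.vertex true)) (appendIf k (.vertex false))))
      (rewind (.reg k))

/-- The state with a list in a register and the head behind it. -/
def withList (k : Reg) (s : Conf) (l : List Letter) : Conf :=
  (setCon s (.reg k) fun j => l.getD j (.entry false)).setPos (.reg k) l.length

theorem run_appendIf (k : Reg) (x : Letter) {s : Conf}
    (hs : s.con .word = fun i => w.getD i default) {m : ℕ} (hm : m < w.length) (l : List Letter)
    (hl : l.length < w.length) :
    run w.length (appendIf k x) ((withList k s l).setPos .word m) =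
      (withList k s (if w[m] = x then l ++ [x] else l)).setPos .word m := by
  have hc : (withList k s l).con .word = fun i => w.getD i default := by
    simpa [withList, setCon] using hs
  rw [appendIf, run_ite, read_setPos_word hc hm]
  by_cases h : w[m] = x
  · simp only [h, decide_true, if_true]
    rw [run_seq]
    have hp : ((withList k s l).setPos .word m).pos (.reg k) = l.length := by
      simp [withList, State.setPos_pos]
    simp only [run, hp, hl, if_true, min_eq_left (Nat.succ_le_of_lt hl)]
    refine State.ext rfl ?_ ?_
    · simp only [withList, State.setPos, setCon, List.length_append, List.length_singleton]
      rw [Function.update_comm (by simp), Function.update_idem]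
    · simp only [withList, State.setPos_con, setCon, Function.update_self, Function.update_idem]
      congr 1
      funext j
      rw [Function.update_apply]
      rcases lt_trichotomy j l.length with hj | rfl | hj
      · simp [hj.ne, List.getD, List.getElem?_append_left hj]
      · simp
      · rw [if_neg hj.ne', List.getD_eq_default _ _ hj.le, List.getD_eq_default]
        simpa using hj
  · simp [h, run_skip]

/-- The register still holds the input, so it is blanked first. After `m` letters of the input it
holds the vertex letters among them. -/
theorem run_loadVertices (k : Reg) {s : Conf} (hs : s.con .word = fun i => w.getD i default)
    (hk : s.con (.reg k) = fun i => w.getD i default) (hw : s.pos .word = 0)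
    (hr : s.pos (.reg k) = 0) :
    run w.length (loadVertices k) s = setCon s (.reg k) (vertexLetter w) := by
  have h1 := run_forEach (N := w.length) (j := Tape.reg k)
    (write (.reg k) fun _ => Letter.entry false) (fun m => setCon s (.reg k)
      fun i => if i < m then .entry false else w.getD i default) (by
    intro m hm
    simp only [run, setCon, State.setPos_pos_self, hm, if_true, State.setPos_con,
      Function.update_self, Function.update_idem]
    refine State.ext rfl rfl ?_
    simp only [State.setPos_con]
    congr 1
    funext i
    rw [Function.update_apply]
    split_ifs <;> first | rfl | omega)
  have e1 : setCon s (.reg k) (fun i => if i < 0 then .entry false else w.getD i default) = s := by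
    simp only [Nat.not_lt_zero, if_false, ← hk]
    simp [setCon]
  have e2 : (setCon s (.reg k)
      fun i => if i < w.length then .entry false else w.getD i default).setPos (.reg k) 0 =
      withList k s [] := by
    rw [withList]
    congr 2
    funext i
    split_ifs with h
    · rfl
    · rw [List.getD_eq_default _ _ (not_lt.1 h)]
      rfl
  rw [e1, State.setPos_eq_self hr, e2] at h1
  have h2 := run_forEach (N := w.length) (j := Tape.word)
    (seq (appendIf k (.vertex true)) (appendIf k (.vertex false)))
    (fun m => withList k s ((w.take m).filter fun a => a matches .vertex _)) (by
      intro m hm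
      -- Ensures that there is still a cell under the register head to write on.
      have hl : ((w.take m).filter fun a => a matches .vertex _).length < w.length := by
        refine (List.length_filter_le _ _).trans_lt ?_
        simpa using hm
      rw [run_seq, run_appendIf k _ hs hm _ hl]
      rw [List.take_add_one, List.getElem?_eq_getElem hm]
      rcases h : w[m] with (_ | _) | x
      · simp only [Letter.vertex.injEq, Bool.false_eq_true, if_false]
        rw [run_appendIf k _ hs hm _ hl]
        simp [h]
      · simp only [if_true]
        -- The lengthened list may already fill the tape, which `run_appendIf` does not allow; the
        -- second append is seen directly to be idle.
        have hc : (withList k s (List.filter (fun a => a matches .vertex _) (w.take m) ++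
            [.vertex true])).con .word = fun i => w.getD i default := by
          simpa [withList, setCon] using hs
        rw [appendIf, run_ite, read_setPos_word hc hm]
        simp [h, run_skip]
      · simp only [reduceCtorEq, if_false]
        rw [run_appendIf k _ hs hm _ hl]
        simp [h])
  have e3 : (withList k s []).setPos .word 0 = withList k s [] := by
    rw [State.setPos_eq_self]
    rw [withList, State.setPos_pos_of_ne _ _ (by simp)]
    exact hw
  simp only [List.take_zero, List.filter_nil] at h2
  rw [e3, List.take_length] at h2
  rw [loadVertices, run_seq, h1, run_seq, h2, run_rewind]
  · rw [withList, State.setPos_comm _ _ _ (by simp), State.setPos_setPos,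
      State.setPos_eq_self (j := Tape.reg k) (by exact hr)]
    exact State.setPos_eq_self hw
  · rw [State.setPos_pos_of_ne _ _ (by simp), withList, State.setPos_pos_self]
    exact List.length_filter_le _ _

/-- Check the form of the input. -/
def checkForm : Program :=
  seq (forEach .word <| ite .word (fun _ _ o => holdsVertex o)
    (seq (load (.reg .b) fun v z _ => { v with ok := v.ok && z }) <|
      seq (rewind (.reg .b)) <| seq (times (.reg .a) .outer (right (.reg .b))) (right (.reg .a)))
    (seq (load (.reg .b) fun v z _ => { v with ok := v.ok && !z }) (left (.reg .b)))) <|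
  seq (load (.reg .b) fun v z _ => { v with ok := v.ok && z }) <|
    seq (rewind (.reg .b)) (rewind (.reg .a))

theorem check_take_succ {m : ℕ} (hm : m < w.length) :
    check (w.take (m + 1)) = checkStep (check (w.take m)) w[m] := by
  rw [check, List.take_add_one, List.getElem?_eq_getElem hm, List.foldl_append]
  rfl

/-- Guarantees that the heads holding the two counters are never stopped at the end of the tape. -/
theorem check_take_le (w : List Letter) : ∀ m ≤ w.length,
    (check (w.take m)).2.1 ≤ m ∧ (check (w.take m)).2.2 ≤ m := by
  intro m
  induction m with
  | zero => intro _; exact ⟨le_rfl, le_rfl⟩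
  | succ m ih =>
    intro hm
    obtain ⟨h1, h2⟩ := ih (by omega)
    rw [check_take_succ hm]
    cases w[m]
    · exact ⟨Nat.succ_le_succ h1, h1.trans (Nat.le_succ _)⟩
    · exact ⟨h1.trans (Nat.le_succ _), (Nat.sub_le _ _).trans (h2.trans (Nat.le_succ _))⟩

theorem run_load_ok (f : Bool → Bool → Bool) (m : ℕ) :
    run w.length (load (.reg .b) fun v z _ => { v with ok := f v.ok z })
      ((conf w ok cyc a b u M).setPos .word m) =
    (conf w (f ok (decide (b = 0))) cyc a b u M).setPos .word m := by
  rw [run_load, State.atStart, State.setPos_pos_of_ne _ _ (by simp)]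
  rfl

/-- Register `a` counts the vertices and `b` the missing entries; opening a vertex resets `b` to the
number of earlier vertices, copied from `a`. -/
theorem run_checkForm : run w.length checkForm (conf w true false 0 0 0 M) =
    conf w ((check w).1 && decide ((check w).2.2 = 0)) false 0 0 0 M := by
  have h := run_forEach (N := w.length) (j := Tape.word)
    (ite .word (fun _ _ o => holdsVertex o)
      (seq (load (.reg .b) fun v z _ => { v with ok := v.ok && z }) <|
        seq (rewind (.reg .b)) <| seq (times (.reg .a) .outer (right (.reg .b))) (right (.reg .a)))
      (seq (load (.reg .b) fun v z _ => { v with ok := v.ok && !z }) (left (.reg .b))))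
    (fun m => conf w (check (w.take m)).1 false (check (w.take m)).2.1 (check (w.take m)).2.2 0 M)
    (by
      intro m hm
      obtain ⟨h1, h2⟩ := check_take_le w m hm.le
      rw [run_ite, read_setPos_word rfl hm, check_take_succ hm]
      revert h1 h2
      rcases check (w.take m) with ⟨ok, c, r⟩
      intro (h1 : c ≤ m) (h2 : r ≤ m)
      cases w[m]
      · simp only [holdsVertex, if_true, checkStep]
        rw [run_seq, run_load_ok fun o z => o && z, run_seq, run_rewind (by
          rw [State.setPos_pos_of_ne _ _ (by simp)]
          exact h2.trans hm.le), State.setPos_comm _ _ _ (by simp), conf_setPos_b, run_seq,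
          run_times_right (by simp) (by simp) (by simp)
            (by rw [State.setPos_pos_of_ne _ _ (by simp)]; exact h1.trans hm.le)
            (by rw [State.setPos_pos_of_ne _ _ (by simp)]; rfl)
            (by rw [State.setPos_pos_of_ne _ _ (by simp)]; exact Nat.zero_le _),
          State.setPos_comm _ _ _ (by simp), conf_setPos_b, run_right,
          State.setPos_comm _ _ _ (by simp), conf_setPos_a]
        simp only [State.setPos_pos, reduceCtorEq, if_false]
        congr 2
        · exact min_eq_left (by change c + 1 ≤ _; omega)
        · change min (0 + c) _ = _
          omega
      · simp only [holdsVertex, Bool.false_eq_true, if_false, checkStep]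
        rw [run_seq, run_load_ok fun o z => o && !z, run_left, State.setPos_comm _ _ _ (by simp),
          conf_setPos_b, State.setPos_pos_of_ne _ _ (by simp)]
        rfl)
  have hb := (check_take_le w _ le_rfl).2
  have ha := (check_take_le w _ le_rfl).1
  rw [List.take_length] at ha hb h
  have e : ∀ ok a b, (conf w ok false a b 0 M).setPos .word 0 = conf w ok false a b 0 M :=
    fun ok a b => State.setPos_eq_self rfl
  rw [e, e] at h
  have h0 : check (w.take 0) = (true, 0, 0) := rfl
  rw [h0] at h
  have hl := run_load_ok (w := w) (ok := (check w).1) (cyc := false) (a := (check w).2.1)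
    (b := (check w).2.2) (u := 0) (M := M) (fun o z => o && z) 0
  rw [e, e] at hl
  rw [checkForm, run_seq, h, run_seq, hl, run_seq,
    run_rewind (j := Tape.reg .b) (by exact hb), conf_setPos_b,
    run_rewind (j := Tape.reg .a) (by exact ha), conf_setPos_a]

/-- Decide if the input encodes an instance whose answer is yes. -/
def decideRet : Program :=
  seq (loadVertices .a) <| seq (loadVertices .b) <| seq (loadVertices .u) <|
    seq (loadVertices .x) <| seq (loadVertices .y) <| seq checkForm searchCycle

/-- The initial state. -/
def initial (w : List Letter) : Conf :=
  ⟨⟨false, false, false, true, false⟩, fun _ => 0, fun _ i => w.getD i default⟩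

/-- The search runs on malformed words too; the outcome of the form check is its initial flag, which
can only turn from true to false. -/
theorem run_decideRet (w : List Letter) : (run w.length decideRet (initial w)).mem.ok =
    ((List.range w.length).foldl (checkVertex w)
      ((check w).1 && decide ((check w).2.2 = 0), fun _ i => w.getD i default)).1 := by
  have e : setCon (setCon (setCon (setCon (setCon (initial w) (.reg .a) (vertexLetter w))
      (.reg .b) (vertexLetter w)) (.reg .u) (vertexLetter w)) (.reg .x) (vertexLetter w))
      (.reg .y) (vertexLetter w) = conf w true false 0 0 0 fun _ i => w.getD i default := by
    refine State.ext rfl (funext fun t => ?_) (funext fun t => ?_) <;>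
      rcases t with _ | _ | _ | _ | _ | (_ | _ | _ | _ | _) <;>
      simp [setCon, initial, conf]
  rw [decideRet, run_seq, run_loadVertices .a rfl rfl rfl rfl, run_seq,
    run_loadVertices .b rfl rfl rfl rfl, run_seq, run_loadVertices .u rfl rfl rfl rfl, run_seq,
    run_loadVertices .x rfl rfl rfl rfl, run_seq, run_loadVertices .y rfl rfl rfl rfl, e, run_seq,
    run_checkForm, run_searchCycle]
  rfl

end OrderedGraph

/-! ## Correctness of the decision procedure -/

namespace OrderedGraph

open HeadProg Relation

/-- The set of marked literals. -/
def markSet (M : Marks) : Set (ℕ × Bool) := {x | marked M x = true}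

theorem mem_addMark {M : Marks} {x y : ℕ × Bool} :
    x ∈ markSet (addMark M y) ↔ x = y ∨ x ∈ markSet M := by
  obtain ⟨i, s⟩ := x
  obtain ⟨j, t⟩ := y
  simp only [markSet, Set.mem_ofPred_eq, marked, addMark, decide_eq_true_eq, Prod.mk.injEq]
  by_cases hs : s = t
  · subst hs
    by_cases hi : i = j
    · simp [hi]
    · simp [hi]
  · simp [hs]

/-! ### Growth of marks under folds. -/

section Fold

variable {ι : Type*} {f : Marks → ι → Marks}

theorem foldl_invariant {P : Marks → Prop} {L : List ι} (h : ∀ M, ∀ i ∈ L, P M → P (f M i)) :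
    ∀ M, P M → P (L.foldl f M) := by
  induction L with
  | nil => exact fun _ hM => hM
  | cons i L ih =>
    intro M hM
    exact ih (fun M j hj => h M j (List.mem_cons_of_mem _ hj)) _ (h M i List.mem_cons_self hM)

theorem markSet_foldl (h : ∀ M i, markSet M ⊆ markSet (f M i)) (L : List ι) (M : Marks) :
    markSet M ⊆ markSet (L.foldl f M) :=
  foldl_invariant (P := fun M' => markSet M ⊆ markSet M') (fun M' i _ hM => hM.trans (h M' i)) M
    Set.Subset.rfl

/-- Marks are never removed, so it is enough that the step for `i` marks `y` regardless of what was
marked before it. -/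
theorem mem_markSet_foldl (h : ∀ M i, markSet M ⊆ markSet (f M i)) {L : List ι} {i : ι}
    (hi : i ∈ L) {M : Marks} {y : ℕ × Bool}
    (hy : ∀ M', markSet M ⊆ markSet M' → y ∈ markSet (f M' i)) :
    y ∈ markSet (L.foldl f M) := by
  obtain ⟨L₁, L₂, rfl⟩ := List.append_of_mem hi
  rw [List.foldl_append, List.foldl_cons]
  exact markSet_foldl h _ _ (hy _ (markSet_foldl h _ _))

end Fold

/-! ### Propagation of marks computes reachability. -/

section Word

variable (w : List Letter)

/-- The implications between the literals of the graph described by the word. -/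
def Implies (x y : ℕ × Bool) : Prop :=
  isVertex w x.1 = true ∧ isVertex w y.1 = true ∧ wordClash w x (TwoSat.neg y) = true

theorem lt_of_isVertex {w : List Letter} {i : ℕ} (h : isVertex w i = true) : i < w.length := by
  by_contra hi
  rw [isVertex, vertexLetter_of_le (not_lt.1 hi)] at h
  cases h

theorem subset_relaxMarks (M : Marks) (x y : ℕ × Bool) :
    markSet M ⊆ markSet (relaxMarks w M x y) := by
  rw [relaxMarks]
  split_ifs
  · exact fun z hz => mem_addMark.2 (.inr hz)
  · exact Set.Subset.rfl

theorem subset_relaxVertices (M : Marks) (a b : ℕ) :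
    markSet M ⊆ markSet (relaxVertices w M a b) :=
  markSet_foldl (fun M _ => subset_relaxMarks w M _ _) _ _

theorem subset_relaxVertices_ite (a : ℕ) (M : Marks) (b : ℕ) :
    markSet M ⊆ markSet (if isVertex w b then relaxVertices w M a b else M) := by
  split_ifs
  · exact subset_relaxVertices w M a b
  · exact Set.Subset.rfl

theorem subset_relaxVertex_ite (M : Marks) (a : ℕ) :
    markSet M ⊆ markSet (if isVertex w a then relaxVertex w M a else M) := by
  split_ifs
  · exact markSet_foldl (subset_relaxVertices_ite w a) _ _
  · exact Set.Subset.rfl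

theorem subset_sweepMarks (M : Marks) : markSet M ⊆ markSet (sweepMarks w M) :=
  markSet_foldl (subset_relaxVertex_ite w) _ _

variable {w}

theorem mem_sweepMarks {M : Marks} {x y : ℕ × Bool} (hx : x ∈ markSet M) (h : Implies w x y) :
    y ∈ markSet (sweepMarks w M) := by
  obtain ⟨hvx, hvy, hc⟩ := h
  refine mem_markSet_foldl (subset_relaxVertex_ite w) (List.mem_range.2 (lt_of_isVertex hvx))
    fun M₁ h₁ => ?_
  rw [if_pos hvx]
  refine mem_markSet_foldl (subset_relaxVertices_ite w x.1)
    (List.mem_range.2 (lt_of_isVertex hvy)) fun M₂ h₂ => ?_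
  rw [if_pos hvy]
  refine mem_markSet_foldl (fun M _ => subset_relaxMarks w M _ _)
    (i := (x.2, y.2)) (by rcases x.2 <;> rcases y.2 <;> simp) fun M₃ h₃ => ?_
  have hx' : marked M₃ x = true := h₃ (h₂ (h₁ hx))
  rw [relaxMarks]
  simp only [Prod.mk.eta, hx', hc, Bool.and_self, if_true]
  exact mem_addMark.2 (.inl rfl)

/-- All marks lie in a set, on the part of the tapes that is in use. -/
def MarksIn (w : List Letter) (S : Set (ℕ × Bool)) (M : Marks) : Prop :=
  ∀ x ∈ markSet M, x.1 < w.length → x ∈ S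

/-- Soundness: a sweep never leaves a set that is closed under implication. Cells past the end of
the tape are disregarded, since clearing does not reach them. -/
theorem marksIn_sweepMarks {S : Set (ℕ × Bool)} (hS : ∀ x ∈ S, ∀ y, Implies w x y → y ∈ S)
    (M : Marks) (hM : MarksIn w S M) : MarksIn w S (sweepMarks w M) := by
  refine foldl_invariant (fun M a _ hM => ?_) M hM
  split_ifs with ha
  · refine foldl_invariant (fun M b _ hM => ?_) M hM
    split_ifs with hb
    · refine foldl_invariant (fun M t _ hM => ?_) M hM
      rw [relaxMarks]
      split_ifs with h
      · rw [Bool.and_eq_true] at h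
        intro x hx hxw
        rcases mem_addMark.1 hx with rfl | hx
        · exact hS _ (hM _ h.1 (lt_of_isVertex ha)) _ ⟨ha, hb, h.2⟩
        · exact hM x hx hxw
      · exact hM
    · exact hM
  · exact hM

/-- Completeness by counting: the marked literals cannot grow strictly in each of `2 * w.length`
sweeps, and once a sweep adds nothing they are closed under implication. -/
theorem mem_iterate_sweepMarks {M : Marks} {x y : ℕ × Bool} (hx : x ∈ markSet M)
    (hxw : x.1 < w.length) (h : ReflTransGen (Implies w) x y) :
    y ∈ markSet ((sweepMarks w)^[2 * w.length] M) := by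
  classical
  let T : ℕ → Finset (ℕ × Bool) := fun k =>
    (Finset.range w.length ×ˢ Finset.univ).filter (· ∈ markSet ((sweepMarks w)^[k] M))
  have hT : ∀ k z, z ∈ T k ↔ z.1 < w.length ∧ z ∈ markSet ((sweepMarks w)^[k] M) := by
    intro k z
    simp [T]
  have hsub : ∀ k, markSet ((sweepMarks w)^[k] M) ⊆ markSet ((sweepMarks w)^[k + 1] M) := by
    intro k
    rw [Function.iterate_succ_apply']
    exact subset_sweepMarks w _
  have hmono : Monotone fun k => markSet ((sweepMarks w)^[k] M) :=
    monotone_nat_of_le_succ hsub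
  obtain ⟨k, hk, hfix⟩ : ∃ k < 2 * w.length, T (k + 1) = T k := by
    by_contra! hne
    -- The set begins with `x` and gains a literal per sweep, which would give more literals than
    -- the `2 * w.length` available.
    have hcard : ∀ k ≤ 2 * w.length, k + 1 ≤ (T k).card := by
      intro k
      induction k with
      | zero => exact fun _ => Finset.card_pos.2 ⟨x, (hT _ _).2 ⟨hxw, hx⟩⟩
      | succ k ih =>
        intro hk
        refine (Nat.succ_le_succ (ih (by omega))).trans (Finset.card_lt_card ?_)
        refine Finset.ssubset_iff_subset_ne.2 ⟨fun z hz => ?_, (hne k (by omega)).symm⟩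
        rw [hT] at hz ⊢
        exact ⟨hz.1, hsub k hz.2⟩
    have h1 := hcard _ le_rfl
    have h2 : (T (2 * w.length)).card ≤ 2 * w.length := by
      refine (Finset.card_filter_le _ _).trans ?_
      simp [Nat.mul_comm]
    omega
  have key : y ∈ T k := by
    induction h with
    | refl => exact (hT _ _).2 ⟨hxw, hmono (Nat.zero_le k) hx⟩
    | tail _ h ih =>
      rw [← hfix, hT, Function.iterate_succ_apply']
      exact ⟨lt_of_isVertex h.2.1, mem_sweepMarks ((hT _ _).1 ih).2 h⟩
  exact hmono hk.le ((hT _ _).1 key).2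

theorem marked_closureMarks {x y : ℕ × Bool} (hx : x.1 < w.length) (hy : y.1 < w.length)
    (M : Marks) : marked (closureMarks w x M) y = true ↔ ReflTransGen (Implies w) x y := by
  rw [closureMarks, ← Function.iterate_mul]
  constructor
  · intro h
    have h0 : MarksIn w {z | ReflTransGen (Implies w) x z} (addMark (noMarks w.length M) x) := by
      intro z hz hzw
      rcases mem_addMark.1 hz with rfl | hz
      · exact .refl
      · simp [markSet, marked, noMarks, hzw] at hz
    have hk : ∀ k, MarksIn w {z | ReflTransGen (Implies w) x z}
        ((sweepMarks w)^[k] (addMark (noMarks w.length M) x)) := by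
      intro k
      induction k with
      | zero => exact h0
      | succ k ih =>
        rw [Function.iterate_succ_apply']
        exact marksIn_sweepMarks (fun a ha b hab => ReflTransGen.tail ha hab) _ ih
    exact hk _ y h hy
  · exact mem_iterate_sweepMarks (mem_addMark.2 (.inl rfl)) hx

/-- Each closure begins by clearing the marks, so those left over from earlier vertices do not
influence the flag. -/
theorem foldl_checkVertex (L : List ℕ) : ∀ s : Bool × Marks,
    (L.foldl (checkVertex w) s).1 = true ↔ s.1 = true ∧ ∀ u ∈ L, isVertex w u = true →
      ¬ (ReflTransGen (Implies w) (u, false) (u, true) ∧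
        ReflTransGen (Implies w) (u, true) (u, false)) := by
  induction L with
  | nil => simp
  | cons u L ih =>
    intro s
    rw [List.foldl_cons, ih, List.forall_mem_cons, checkVertex, ← and_assoc]
    refine and_congr_left fun _ => ?_
    split_ifs with hu
    · have hw := lt_of_isVertex hu
      rw [Bool.and_eq_true, Bool.not_eq_true', ← Bool.not_eq_true, Bool.and_eq_true,
        marked_closureMarks hw hw, marked_closureMarks hw hw]
      simp [hu]
    · simp [hu]

end Word

/-! ### From words back to instances. -/

section Instance

variable (I : RetInstance)

theorem RetInstance.isVertex_encode (i : ℕ) : isVertex I.encode i = decide (i < I.n) := by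
  rw [isVertex, I.vertexLetter_encode]
  split_ifs with h <;> simp [h]

theorem RetInstance.isChosen_encode : isChosen I.encode = I.chosen := by
  funext i
  rw [isChosen, I.vertexLetter_encode]
  split_ifs with h
  · simp
  · have := mt (I.lt_of_chosen (i := i)) h
    simp [this]

theorem RetInstance.areAdj_encode : areAdj I.encode = I.adj := by
  funext i j
  exact (I.adj_eq_entryAt i j).symm

/-- A literal of the instance as a literal of the word. -/
def RetInstance.lit (x : Fin I.n × Bool) : ℕ × Bool := (x.1, x.2)

/-- The conflicts between the literals of the instance. -/
def RetInstance.Bad (x y : Fin I.n × Bool) : Prop :=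
  clash I.encode.length I.chosen I.adj (I.lit x) (I.lit y) = true

theorem RetInstance.bad_symm (x y : Fin I.n × Bool) (h : I.Bad x y) : I.Bad y x := by
  rw [Bad, clash, conflict_comm I.adj_comm]
  exact h

theorem RetInstance.implies_iff (x y : Fin I.n × Bool) :
    Implies I.encode (I.lit x) (I.lit y) ↔ TwoSat.Edge I.Bad x y := by
  simp [Implies, I.isVertex_encode, wordClash, I.isChosen_encode, I.areAdj_encode, TwoSat.Edge,
    Bad, lit, TwoSat.neg]

/-- Implications of the word connect only vertices, so a walk that starts at a literal of the
instance stays among such literals. -/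
theorem RetInstance.reach_iff (x y : Fin I.n × Bool) :
    ReflTransGen (Implies I.encode) (I.lit x) (I.lit y) ↔
      ReflTransGen (TwoSat.Edge I.Bad) x y := by
  constructor
  · intro h
    have key : ∀ z, ReflTransGen (Implies I.encode) (I.lit x) z →
        ∃ y, I.lit y = z ∧ ReflTransGen (TwoSat.Edge I.Bad) x y := by
      intro z hz
      induction hz with
      | refl => exact ⟨x, rfl, .refl⟩
      | @tail b c _ h ih =>
        obtain ⟨y, rfl, hy⟩ := ih
        have hc : c.1 < I.n := by simpa [I.isVertex_encode] using h.2.1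
        exact ⟨(⟨c.1, hc⟩, c.2), rfl, hy.tail ((I.implies_iff _ (⟨c.1, hc⟩, c.2)).1 h)⟩
    obtain ⟨y', he, hy'⟩ := key _ h
    have : y' = y := by
      simp only [lit, Prod.mk.injEq] at he
      exact Prod.ext (Fin.ext he.1) he.2
    exact this ▸ hy'
  · exact fun h => h.lift _ fun a b hab => (I.implies_iff a b).2 hab

/-- Joins the three ingredients: retractions are clash-free choices, these exist when there are no
contradictory cycles, and the fold searches for such cycles. -/
theorem RetInstance.isYes_iff_foldl (M : Marks) : I.IsYes ↔
    ((List.range I.encode.length).foldl (checkVertex I.encode) (true, M)).1 = true := by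
  rw [I.isYes_iff _ I.n_le_length_encode, foldl_checkVertex]
  refine (TwoSat.exists_assignment_iff (bad := I.Bad) I.bad_symm).trans ?_
  simp only [true_and, List.mem_range, I.isVertex_encode, decide_eq_true_eq, ← I.reach_iff]
  exact ⟨fun h u _ hu => h ⟨u, hu⟩, fun h u => h u (u.2.trans_le I.n_le_length_encode) u.2⟩

end Instance

theorem mem_RET_iff (w : List Letter) :
    w ∈ RET ↔ (run w.length decideRet (initial w)).mem.ok = true := by
  rw [run_decideRet]
  by_cases h : ∃ I : RetInstance, I.encode = w
  · have h' := (exists_encode_eq_iff w).1 h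
    obtain ⟨I, rfl⟩ := h
    rw [h'.1, h'.2, decide_eq_true rfl, Bool.and_self, ← I.isYes_iff_foldl]
    constructor
    · rintro ⟨J, hJ, hyes⟩
      -- Membership in the language may be witnessed by another instance with the same word;
      -- injectivity identifies the two.
      rwa [← RetInstance.encode_injective hJ]
    · exact fun hyes => ⟨I, rfl, hyes⟩
  · have hn : w ∉ RET := fun ⟨I, hI, _⟩ => h ⟨I, hI⟩
    rw [exists_encode_eq_iff] at h
    simp only [hn, foldl_checkVertex, Bool.and_eq_true, decide_eq_true_eq, h, false_and]

end OrderedGraph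

theorem theorem2 : OrderedGraph.RET ∈ OrderedGraph.PolyTime OrderedGraph.Letter := by
  have h := HeadProg.nonempty_computableInPolyTime OrderedGraph.decideRet
    ⟨false, false, false, true, false⟩ OrderedGraph.Flags.ok
  -- The classical instance is spelled out so that it agrees with the one in `PolyTime`.
  have e : (fun w => @decide (w ∈ OrderedGraph.RET) (Classical.propDecidable _)) = fun w : List OrderedGraph.Letter =>
      (HeadProg.run w.length OrderedGraph.decideRet (OrderedGraph.initial w)).mem.ok := by
    funext w
    exact Bool.eq_iff_iff.2 ((@decide_eq_true_iff _ (_)).trans (OrderedGraph.mem_RET_iff w))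
  change Nonempty _
  rw [e]
  exact h
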